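/- Let $\gamma>1$, $m_0>0$, $S_0>0$, $G_0\in\mathbb R$, $L>0$, $\delta_0\in(0,1)$, put $\rho_c=\big(m_0^2/(\gamma e^{S_0})\big)^{1/(\gamma+1)}$ and let $\rho_0>\rho_c$. Let $\Omega_L=(0,L)\times(-1,1)$, with entrance $\Gamma_{en}=\{0\}\times(-1,1)$, exit $\Gamma_{ex}=\{L\}\times(-1,1)$ and walls $\Gamma_w=(0,L)\times\{-1,1\}$. There are constants $c,C>0$ depending only on $(\gamma,m_0,S_0,\rho_0,G_0,L)$ and $\delta_0$ such that the following holds. Let $(\rho,G)$ be a classical solution on $[0,L]$, with $\rho>0$ and $\rho\ne\rho_c$, of $$\rho'=\frac{-\rho G}{\gamma e^{S_0}\rho^{\gamma-1}-m_0^2/\rho^2},\qquad G'=\rho,\qquad \rho(0)=\rho_0,\quad G(0)=G_0,$$ and suppose that $\bar\rho(x)=\rho(x_1)$ satisfies $$\frac{\bar\rho L^2}{2\big(\gamma e^{S_0}\bar\rho^{\gamma-1}-m_0^2/\bar\rho^2\big)}\le 1-\delta_0\quad\text{in }\Omega_L .$$ Put $\psi_0(x)=m_0(x_2+1)$ and $\Phi_0(x)=\int_0^{x_1}G\,dt-\Big(\frac{m_0^2}{2\rho_0^2}+\frac{\gamma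 e^{S_0}\rho_0^{\gamma-1}}{\gamma-1}\Big)$. Let $Q(q,z,s)$ be the subsonic solution $\varsigma=Q>0$ of $$\mathcal G(\varsigma,q,z,s):=\frac{|q|^2}{2\varsigma^2}+\frac{\gamma\varsigma^{\gamma-1}e^s}{\gamma-1}+z=0,$$ that is, the solution with $\partial_\varsigma\mathcal G>0$, and let $A_i=q_i/Q$, $B=Q$. Define, with all derivatives evaluated at $(\nabla\psi_0(x),\Phi_0(x),S_0)$, $$\mathfrak a_{ij}=\partial_{q_j}A_i,\quad \mathfrak b_i=\partial_zA_i,\quad \mathfrak c_i=\partial_{q_i}B,\quad \mathfrak d=\partial_zB .$$ Let $\mathcal H$ be the set of all $(\zeta,\omega)\in[H^1(\Omega_L)]^2$ with $\zeta=0$ on $\Gamma_w\cup\Gamma_{ex}$ and $\omega=0$ on $\Gamma_{ex}$ in the sense of traces, and let $$\mathfrak L[(u,V),(\zeta,\omega)]=\int_{\Omega_L}\sum_{i=1}^2(\mathfrak a_{ii}\partial_iu+\mathfrak b_iV)\partial_i\zeta+\nabla V\cdot\nabla\omega+\Big(\mathfrak dV+\sum_{i=1}^2\mathfrak c_i\partial_iu\Big)\omega\,dx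 .$$ Below, $\|(\zeta,\omega)\|_{H^1}=\|\zeta\|_{H^1}+\|\omega\|_{H^1}$. Then: 1. (Coercivity) $\mathfrak L[(\zeta,\omega),(\zeta,\omega)]\ge c\,\|(\zeta,\omega)\|_{H^1(\Omega_L)}^2$ for all $(\zeta,\omega)\in\mathcal H$. 2. (Unique solvability) For all $\mathfrak f,\mathfrak g^*\in C^0(\overline{\Omega_L})$, $\mathfrak F^*,\mathfrak G^*\in C^0(\overline{\Omega_L};\mathbb R^2)$ and $g_{en}\in C^0(\overline{\Gamma_{en}})$ there is exactly one weak solution, i.e. exactly one $(u,V)\in\mathcal H$ such that for all $(\zeta,\omega)\in\mathcal H$ $$\mathfrak L[(u,V),(\zeta,\omega)]=\int_{\Omega_L}\mathfrak F^*\cdot\nabla\zeta+\mathfrak G^*\cdot\nabla\omega\,dx-\int_{\Omega_L}\mathfrak f\zeta+\mathfrak g^*\omega\,dx+\int_{\Gamma_{en}}(\mathfrak F^*_1\zeta-g_{en}\omega)\,dx_2 ,$$ and it satisfies $$\|(u,V)\|_{H^1(\Omega_L)}\le C\big(\|(\mathfrak f,\mathfrak g^*,\mathfrak G^*,\mathfrak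 F^*)\|_{C^0(\overline{\Omega_L})}+\|g_{en}\|_{C^0(\overline{\Gamma_{en}})}\big).$$ -/

import Mathlib

open MeasureTheory Set Filter Topology
open scoped ContDiff

noncomputable section

namespace DuctFlow

/-! ### The duct and partial derivatives -/

/-- The duct `Ω_L = (0, L) × (-1, 1)`. -/
def duct (L : ℝ) : Set (ℝ × ℝ) := Ioo 0 L ×ˢ Ioo (-1) 1

/-- The coordinate vectors of the plane; index `0` is the `x₁` direction, index `1` is `x₂`. -/
def basisVec (i : Fin 2) : ℝ × ℝ := ![((1 : ℝ), (0 : ℝ)), ((0 : ℝ), (1 : ℝ))] i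

/-- The partial derivative `∂ᵢ φ` at `x`. -/
def partialD (i : Fin 2) (φ : ℝ × ℝ → ℝ) (x : ℝ × ℝ) : ℝ := fderiv ℝ φ x (basisVec i)

/-- Lebesgue measure on the duct. -/
abbrev ductMeasure (L : ℝ) : Measure (ℝ × ℝ) := volume.restrict (duct L)

/-! ### One dimensional background flows -/

/-- The numerical data of a background flow: adiabatic constant, mass flux, entropy, density and
field at the entrance, and length of the duct. -/
structure BackgroundData where
  γ : ℝ
  m₀ : ℝ
  S₀ : ℝ
  ρ₀ : ℝ
  G₀ : ℝ
  L : ℝ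

namespace BackgroundData

variable (D : BackgroundData)

/-- The critical (sonic) density `(m₀² / (γ e^{S₀}))^{1/(γ+1)}`. -/
def criticalDensity : ℝ := (D.m₀ ^ 2 / (D.γ * Real.exp D.S₀)) ^ (1 / (D.γ + 1))

/-- `γ e^{S₀} r^{γ-1} - m₀² / r²`. -/
def sonicGap (r : ℝ) : ℝ := D.γ * Real.exp D.S₀ * r ^ (D.γ - 1) - D.m₀ ^ 2 / r ^ 2

/-- `(ρ, G)` is a classical solution on `[0, L]` of
`ρ' = -ρ G / (γ e^{S₀} ρ^{γ-1} - m₀² / ρ²)`, `G' = ρ`, `ρ(0) = ρ₀`, `G(0) = G₀`,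
staying in the region `ρ > 0`, `ρ ≠ ρ_c` where the right-hand side is regular. -/
structure IsBackground (ρ G : ℝ → ℝ) : Prop where
  init_density : ρ 0 = D.ρ₀
  init_field : G 0 = D.G₀
  density_pos : ∀ t ∈ Icc 0 D.L, 0 < ρ t
  density_ne : ∀ t ∈ Icc 0 D.L, ρ t ≠ D.criticalDensity
  density_ode : ∀ t ∈ Icc 0 D.L,
    HasDerivWithinAt ρ (-(ρ t * G t) / D.sonicGap (ρ t)) (Icc 0 D.L) t
  field_ode : ∀ t ∈ Icc 0 D.L, HasDerivWithinAt G (ρ t) (Icc 0 D.L) t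

/-- The smallness condition
`ρ̄ L² / (2 (γ e^{S₀} ρ̄^{γ-1} - m₀² / ρ̄²)) ≤ 1 - δ₀` in the duct, where `ρ̄(x) = ρ(x₁)`. -/
def IsSmall (ρ : ℝ → ℝ) (δ₀ : ℝ) : Prop :=
  ∀ x ∈ duct D.L, ρ x.1 * D.L ^ 2 / (2 * D.sonicGap (ρ x.1)) ≤ 1 - δ₀

/-- The background stream function `ψ₀(x) = m₀ (x₂ + 1)`. -/
def psi₀ (x : ℝ × ℝ) : ℝ := D.m₀ * (x.2 + 1)

/-- The background potential
`Φ₀(x) = ∫₀^{x₁} G - (m₀² / (2 ρ₀²) + γ e^{S₀} ρ₀^{γ-1} / (γ - 1))`. -/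
def Phi₀ (G : ℝ → ℝ) (x : ℝ × ℝ) : ℝ :=
  (∫ t in (0 : ℝ)..x.1, G t) -
    (D.m₀ ^ 2 / (2 * D.ρ₀ ^ 2) + D.γ * Real.exp D.S₀ * D.ρ₀ ^ (D.γ - 1) / (D.γ - 1))

end BackgroundData

/-! ### The density as a function of `(∇ψ, Φ, S, 𝒦)` and the coefficients -/

/-- The Bernoulli relation
`𝒢(ς, q, z, s, η) = |q|² / (2 ς²) + γ ς^{γ-1} e^s / (γ - 1) + z - η`. -/
def bernoulli (γ ς : ℝ) (q : Fin 2 → ℝ) (z s η : ℝ) : ℝ :=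
  (∑ i, q i ^ 2) / (2 * ς ^ 2) + γ * ς ^ (γ - 1) * Real.exp s / (γ - 1) + z - η

/-- `ς` is a subsonic density for `(q, z, s, η)`: a positive zero of `𝒢(·, q, z, s, η)` at which
`∂𝒢/∂ς > 0`. There is at most one. -/
def IsSubsonicRoot (γ : ℝ) (q : Fin 2 → ℝ) (z s η ς : ℝ) : Prop :=
  0 < ς ∧ bernoulli γ ς q z s η = 0 ∧ 0 < deriv (fun r => bernoulli γ r q z s η) ς

open Classical in
/-- The subsonic solution `Q(q, z, s, η)` of `𝒢(Q, q, z, s, η) = 0` (`0` if there is none). Close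
to a subsonic background state it is the solution given by the implicit function theorem. -/
def density (γ : ℝ) (q : Fin 2 → ℝ) (z s η : ℝ) : ℝ :=
  if h : ∃ ς, IsSubsonicRoot γ q z s η ς then h.choose else 0

/-- `A_i(q, z, s) = q_i / Q(q, z, s, 0)`. -/
def fluxA (γ : ℝ) (i : Fin 2) (q : Fin 2 → ℝ) (z s : ℝ) : ℝ := q i / density γ q z s 0

/-- `B(q, z, s) = Q(q, z, s, 0)`. -/
def sourceB (γ : ℝ) (q : Fin 2 → ℝ) (z s : ℝ) : ℝ := density γ q z s 0

namespace BackgroundData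

variable (D : BackgroundData) (G : ℝ → ℝ)

/-- `∇ψ₀(x)` as a vector of `ℝ²`. -/
def gradPsi₀ (x : ℝ × ℝ) : Fin 2 → ℝ := fun i => partialD i D.psi₀ x

/-- `𝔞_{ij}(x) = ∂_{q_j} A_i (∇ψ₀(x), Φ₀(x), S₀)`. -/
def coefA (i j : Fin 2) (x : ℝ × ℝ) : ℝ :=
  deriv (fun t => fluxA D.γ i (Function.update (D.gradPsi₀ x) j t) (D.Phi₀ G x) D.S₀)
    (D.gradPsi₀ x j)

/-- `𝔟_i(x) = ∂_z A_i (∇ψ₀(x), Φ₀(x), S₀)`. -/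
def coefB (i : Fin 2) (x : ℝ × ℝ) : ℝ :=
  deriv (fun z => fluxA D.γ i (D.gradPsi₀ x) z D.S₀) (D.Phi₀ G x)

/-- `𝔠_i(x) = ∂_{q_i} B (∇ψ₀(x), Φ₀(x), S₀)`. -/
def coefC (i : Fin 2) (x : ℝ × ℝ) : ℝ :=
  deriv (fun t => sourceB D.γ (Function.update (D.gradPsi₀ x) i t) (D.Phi₀ G x) D.S₀)
    (D.gradPsi₀ x i)

/-- `𝔡(x) = ∂_z B (∇ψ₀(x), Φ₀(x), S₀)`. -/
def coefD (x : ℝ × ℝ) : ℝ :=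
  deriv (fun z => sourceB D.γ (D.gradPsi₀ x) z D.S₀) (D.Phi₀ G x)

end BackgroundData

/-! ### The Sobolev space `H¹` of the duct and traces -/

/-- An element of `H¹(Ω_L)`: a class `val ∈ L²(Ω_L)` together with its (unique) weak gradient
`grad ∈ L²(Ω_L)²`. -/
@[ext]
structure H1 (L : ℝ) where
  val : Lp ℝ 2 (ductMeasure L)
  grad : Fin 2 → Lp ℝ 2 (ductMeasure L)
  weak : ∀ (i : Fin 2) (φ : ℝ × ℝ → ℝ), ContDiff ℝ ∞ φ → HasCompactSupport φ →
    tsupport φ ⊆ duct L →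
    ∫ x in duct L, val x * partialD i φ x = -∫ x in duct L, grad i x * φ x

/-- The norm of `H¹(Ω_L)`. -/
def H1.norm {L : ℝ} (u : H1 L) : ℝ := √(‖u.val‖ ^ 2 + ∑ i, ‖u.grad i‖ ^ 2)

/-- The norm of a pair: the sum of the norms of the components. -/
def pairNorm {L : ℝ} (p : H1 L × H1 L) : ℝ := p.1.norm + p.2.norm

/-- `τ ∈ L²(I)` is the trace of `u` along the boundary segment `t ↦ e t`, `t ∈ I`: there are
functions `φₙ`, smooth up to the boundary, with `φₙ → u` in `H¹(Ω_L)` and `φₙ ∘ e → τ` in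
`L²(I)`. -/
def HasTrace {L : ℝ} (u : H1 L) (e : ℝ → ℝ × ℝ) (I : Set ℝ) (τ : ℝ → ℝ) : Prop :=
  MemLp τ 2 (volume.restrict I) ∧
  ∃ φ : ℕ → ℝ × ℝ → ℝ, (∀ n, ContDiff ℝ ∞ (φ n)) ∧
    Tendsto (fun n => eLpNorm (fun x => φ n x - u.val x) 2 (ductMeasure L)) atTop (𝓝 0) ∧
    (∀ i, Tendsto (fun n => eLpNorm (fun x => partialD i (φ n) x - u.grad i x) 2 (ductMeasure L))
      atTop (𝓝 0)) ∧
    Tendsto (fun n => eLpNorm (fun t => φ n (e t) - τ t) 2 (volume.restrict I)) atTop (𝓝 0)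

/-- `u = 0` on the walls `(0, L) × {-1, 1}`, in the sense of traces. -/
def VanishesOnWalls {L : ℝ} (u : H1 L) : Prop :=
  HasTrace u (fun t => (t, -1)) (Ioo 0 L) 0 ∧ HasTrace u (fun t => (t, 1)) (Ioo 0 L) 0

/-- `u = 0` on the exit `{L} × (-1, 1)`, in the sense of traces. -/
def VanishesOnExit {L : ℝ} (u : H1 L) : Prop :=
  HasTrace u (fun t => (L, t)) (Ioo (-1) 1) 0

open Classical in
/-- The trace of `u` on the entrance `{0} × (-1, 1)`, as a function of `x₂`. -/
def entranceTrace {L : ℝ} (u : H1 L) : ℝ → ℝ :=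
  if h : ∃ τ, HasTrace u (fun t => (0, t)) (Ioo (-1) 1) τ then h.choose else 0

/-- The space `ℋ` of pairs `(ζ, ω) ∈ H¹ × H¹` with `ζ = 0` on the walls and on the exit and
`ω = 0` on the exit. -/
def spaceH (L : ℝ) : Set (H1 L × H1 L) :=
  {p | VanishesOnWalls p.1 ∧ VanishesOnExit p.1 ∧ VanishesOnExit p.2}

/-! ### The weak formulation -/

/-- The bilinear form
`𝔏[(u,V),(ζ,ω)] = ∫ ∑ᵢ (𝔞ᵢᵢ ∂ᵢu + 𝔟ᵢ V) ∂ᵢζ + ∇V · ∇ω + (𝔡 V + ∑ᵢ 𝔠ᵢ ∂ᵢu) ω dx`. -/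
def bilinForm (D : BackgroundData) (G : ℝ → ℝ) (p r : H1 D.L × H1 D.L) : ℝ :=
  ∫ x in duct D.L,
    ((∑ i, (D.coefA G i i x * p.1.grad i x + D.coefB G i x * p.2.val x) * r.1.grad i x)
      + (∑ i, p.2.grad i x * r.2.grad i x)
      + (D.coefD G x * p.2.val x + ∑ i, D.coefC G i x * p.1.grad i x) * r.2.val x)

/-- The data `(𝔣, 𝔉*, 𝔤*, 𝔊*, g_en)` of the linear problem; `gen` is a function of `x₂`. -/
structure LinearData where
  f : ℝ × ℝ → ℝ
  F : Fin 2 → ℝ × ℝ → ℝ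
  g : ℝ × ℝ → ℝ
  G : Fin 2 → ℝ × ℝ → ℝ
  gen : ℝ → ℝ

/-- The interior data are continuous on the closed duct and `g_en` on the closed entrance. -/
structure LinearData.IsC0 (d : LinearData) (L : ℝ) : Prop where
  f : ContinuousOn d.f (closure (duct L))
  F : ∀ i, ContinuousOn (d.F i) (closure (duct L))
  g : ContinuousOn d.g (closure (duct L))
  G : ∀ i, ContinuousOn (d.G i) (closure (duct L))
  gen : ContinuousOn d.gen (Icc (-1) 1)

/-- The `C⁰` norm on a set. -/
def supNorm {X : Type*} (s : Set X) (h : X → ℝ) : ℝ := sSup ((fun x => |h x|) '' s)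

/-- `‖(𝔣, 𝔤*, 𝔊*, 𝔉*)‖_{C⁰}` on the closed duct plus `‖g_en‖_{C⁰}` on the closed entrance. -/
def LinearData.norm (d : LinearData) (L : ℝ) : ℝ :=
  (supNorm (closure (duct L)) d.f + supNorm (closure (duct L)) d.g
    + (∑ i, supNorm (closure (duct L)) (d.G i)) + ∑ i, supNorm (closure (duct L)) (d.F i))
    + supNorm (Icc (-1) 1) d.gen

/-- The linear functional
`∫ 𝔉*·∇ζ + 𝔊*·∇ω dx - ∫ 𝔣 ζ + 𝔤* ω dx + ∫_{entrance} (𝔉*₁ ζ - g_en ω) dx₂`. -/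
def LinearData.functional {L : ℝ} (d : LinearData) (r : H1 L × H1 L) : ℝ :=
  (∫ x in duct L, ((∑ i, d.F i x * r.1.grad i x) + ∑ i, d.G i x * r.2.grad i x))
    - (∫ x in duct L, (d.f x * r.1.val x + d.g x * r.2.val x))
    + ∫ t in Ioo (-1 : ℝ) 1,
        (d.F 0 (0, t) * entranceTrace r.1 t - d.gen t * entranceTrace r.2 t)

/-- `p = (u, V) ∈ ℋ` is a weak solution of the linear problem: `𝔏[p, r] = ⟨data, r⟩` for all
`r = (ζ, ω) ∈ ℋ`. -/
def IsWeakSolution (D : BackgroundData) (G : ℝ → ℝ) (d : LinearData)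
    (p : H1 D.L × H1 D.L) : Prop :=
  p ∈ spaceH D.L ∧ ∀ r ∈ spaceH D.L, bilinForm D G p r = d.functional r

end DuctFlow

end

open DuctFlow

noncomputable section

namespace DuctFlow

/-! ### The subsonic density -/

/-! The background density never meets `criticalDensity`, so it stays above it, and there the sonic
gap g = γ e^{S₀} ρ^{γ-1} - m₀²/ρ² is positive. The Bernoulli law then shows that Q(∇ψ₀, Φ₀, S₀) is
exactly ρ̄. Implicit differentiation with q = (0, m₀) gives 𝔞ᵢᵢ = 1/ρ̄ + qᵢ²/(ρ̄³g), 𝔟ᵢ = qᵢ/(ρ̄g),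
𝔠ᵢ = -𝔟ᵢ and 𝔡 = -ρ̄/g.

Since 𝔟ᵢ + 𝔠ᵢ = 0, the mixed terms cancel on the diagonal (`bilinForm_self`), which leaves ∫ Σ
𝔞ᵢᵢ|∂ᵢζ|² + |∇ω|² - (ρ̄/g)ω². The only negative term is controlled by the Poincaré inequality ‖ω‖² ≤
(L²/2)‖∂₁ω‖² for functions vanishing on the exit (`poincare`): the smallness condition says ρ̄/g ≤
2(1-δ₀)/L², so a fraction δ₀ of ‖∂₁ω‖² survives. The first term is at least ‖∇ζ‖²/M, where M bounds
all background densities in terms of the data (`exists_density_bound`): G increases, so Φ₀ is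
bounded below and the Bernoulli law caps ρ. Poincaré for ζ and ω then recovers the full H¹ norms
(`coercive_bilinForm`).

Solvability is Lax–Milgram on a closed subspace of a power of L². For this, traces are described by
the closure of the graph of restriction on smooth functions (`traceGraph`). Boundary conditions
become closed linear conditions, and inequalities proved on horizontal lines for smooth functions
pass to the closure. The entrance trace obtained in this way is bounded, hence so is the right-hand
side (`exists_functional_le`). Testing the equation with its own solution gives the estimate. -/

theorem hasDerivAt_bernoulli {γ ς : ℝ} (hγ : 1 < γ) (hς : 0 < ς) (q : Fin 2 → ℝ) (z s η : ℝ) :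
    HasDerivAt (fun r => bernoulli γ r q z s η)
      ((γ * ς ^ (γ - 1) * Real.exp s - (∑ i, q i ^ 2) / ς ^ 2) / ς) ς := by
  have h1 : HasDerivAt (fun r : ℝ => r ^ (γ - 1)) ((γ - 1) * ς ^ (γ - 1 - 1)) ς :=
    Real.hasDerivAt_rpow_const (Or.inl hς.ne')
  have h2 : HasDerivAt (fun r : ℝ => 2 * r ^ 2) (2 * (2 * ς)) ς := by
    simpa using (hasDerivAt_pow 2 ς).const_mul 2
  have h3 := (((hasDerivAt_const ς (∑ i, q i ^ 2)).div h2 (by positivity)).add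
    (((h1.const_mul γ).mul_const (Real.exp s)).div_const (γ - 1))).add_const z |>.sub_const η
  refine h3.congr_deriv ?_
  have hγ' : γ - 1 ≠ 0 := by linarith
  rw [Real.rpow_sub_one hς.ne' (γ - 1)]
  field_simp
  ring

theorem isSubsonicRoot_iff {γ ς : ℝ} (hγ : 1 < γ) (q : Fin 2 → ℝ) (z s η : ℝ) :
    IsSubsonicRoot γ q z s η ς ↔ 0 < ς ∧ bernoulli γ ς q z s η = 0 ∧
      0 < γ * ς ^ (γ - 1) * Real.exp s - (∑ i, q i ^ 2) / ς ^ 2 := by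
  unfold IsSubsonicRoot
  refine and_congr_right fun hς => and_congr_right fun _ => ?_
  rw [(hasDerivAt_bernoulli hγ hς q z s η).deriv, div_pos_iff_of_pos_right hς]

theorem subsonic_gap_mono {γ a b N s : ℝ} (hγ : 1 < γ) (hN : 0 ≤ N) (ha : 0 < a) (hab : a ≤ b) :
    γ * a ^ (γ - 1) * Real.exp s - N / a ^ 2 ≤ γ * b ^ (γ - 1) * Real.exp s - N / b ^ 2 := by
  have h1 : a ^ (γ - 1) ≤ b ^ (γ - 1) := Real.rpow_le_rpow ha.le hab (by linarith)
  have h2 : N / b ^ 2 ≤ N / a ^ 2 := by gcongr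
  have h3 : γ * a ^ (γ - 1) * Real.exp s ≤ γ * b ^ (γ - 1) * Real.exp s := by gcongr
  linarith

/-- The gap increases with the density, so once positive at a it stays positive on [a, b]. The
Bernoulli function is then strictly increasing there and cannot vanish at both ends. -/
theorem IsSubsonicRoot.not_lt {γ a b : ℝ} (hγ : 1 < γ) {q : Fin 2 → ℝ} {z s η : ℝ}
    (ha : IsSubsonicRoot γ q z s η a) (hb : IsSubsonicRoot γ q z s η b) : ¬ a < b := by
  intro hab
  rw [isSubsonicRoot_iff hγ] at ha hb
  have hmono : StrictMonoOn (fun r => bernoulli γ r q z s η) (Icc a b) := by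
    refine strictMonoOn_of_deriv_pos (convex_Icc a b) (fun r hr => ?_) fun r hr => ?_
    · exact (hasDerivAt_bernoulli hγ (ha.1.trans_le hr.1) q z s η).continuousAt.continuousWithinAt
    · rw [interior_Icc] at hr
      have hr0 : 0 < r := ha.1.trans hr.1
      rw [(hasDerivAt_bernoulli hγ hr0 q z s η).deriv]
      refine div_pos (ha.2.2.trans_le ?_) hr0
      exact subsonic_gap_mono hγ (Finset.sum_nonneg fun i _ => sq_nonneg _) ha.1 hr.1.le
  have := hmono (left_mem_Icc.2 hab.le) (right_mem_Icc.2 hab.le) hab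
  simp only [ha.2.1, hb.2.1, lt_irrefl] at this

theorem density_eq {γ ς : ℝ} (hγ : 1 < γ) {q : Fin 2 → ℝ} {z s η : ℝ}
    (h : IsSubsonicRoot γ q z s η ς) : density γ q z s η = ς := by
  have hex : ∃ ς, IsSubsonicRoot γ q z s η ς := ⟨ς, h⟩
  rw [density, dif_pos hex]
  exact le_antisymm (not_lt.1 (h.not_lt hγ hex.choose_spec))
    (not_lt.1 (hex.choose_spec.not_lt hγ h))

/-- Implicit differentiation of the subsonic density along a curve `t ↦ (q t, z t)`. -/
theorem hasDerivAt_density {γ s t₀ ς N' z' : ℝ} (hγ : 1 < γ) {q : ℝ → Fin 2 → ℝ} {z : ℝ → ℝ}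
    (hN : HasStrictDerivAt (fun t => ∑ i, q t i ^ 2) N' t₀) (hz : HasStrictDerivAt z z' t₀)
    (h : IsSubsonicRoot γ (q t₀) (z t₀) s 0 ς) :
    HasDerivAt (fun t => density γ (q t) (z t) s 0)
      (-(N' / (2 * ς ^ 2) + z') * ς /
        (γ * ς ^ (γ - 1) * Real.exp s - (∑ i, q t₀ i ^ 2) / ς ^ 2)) t₀ := by
  obtain ⟨hς, h0, hgap⟩ := (isSubsonicRoot_iff hγ _ _ _ _).1 h
  set N : ℝ → ℝ := fun t => ∑ i, q t i ^ 2 with hNdef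
  let f : ℝ × ℝ → ℝ := fun y => bernoulli γ y.2 (q y.1) (z y.1) s 0
  have hp : HasStrictDerivAt (fun r : ℝ => r ^ (γ - 1)) ((γ - 1) * ς ^ (γ - 1 - 1)) ς :=
    Real.hasStrictDerivAt_rpow_const (Or.inl hς.ne')
  obtain ⟨f', hf'⟩ : ∃ f', HasStrictFDerivAt f f' (t₀, ς) := by
    have hfst : ∀ {g : ℝ → ℝ} {g' : ℝ}, HasStrictDerivAt g g' t₀ →
        HasStrictFDerivAt (fun y : ℝ × ℝ => g y.1) (g' • .fst ℝ ℝ ℝ) (t₀, ς) := fun h =>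
      HasStrictDerivAt.comp_hasStrictFDerivAt (f := Prod.fst) (t₀, ς) h hasStrictFDerivAt_fst
    have hsnd : ∀ {g : ℝ → ℝ} {g' : ℝ}, HasStrictDerivAt g g' ς →
        HasStrictFDerivAt (fun y : ℝ × ℝ => g y.2) (g' • .snd ℝ ℝ ℝ) (t₀, ς) := fun h =>
      HasStrictDerivAt.comp_hasStrictFDerivAt (f := Prod.snd) (t₀, ς) h hasStrictFDerivAt_snd
    have hi : HasStrictDerivAt (fun r : ℝ => (2 * r ^ 2)⁻¹) (-((2 * ς ^ 2) ^ 2)⁻¹ * (2 * (2 * ς))) ς := by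
      have h2 : HasStrictDerivAt (fun r : ℝ => 2 * r ^ 2) (2 * (2 * ς)) ς := by
        simpa using (hasStrictDerivAt_pow 2 ς).const_mul 2
      exact (hasStrictDerivAt_inv (x := 2 * ς ^ 2) (by positivity)).comp ς h2
    have := (((hfst hN).mul (hsnd hi)).add ((((hsnd hp).const_mul γ).mul_const (Real.exp s)).mul_const
      (γ - 1)⁻¹)).add (hfst hz)
    exact ⟨_, this.congr_of_eventuallyEq (Eventually.of_forall fun y => by
      simp [f, bernoulli, N, div_eq_mul_inv])⟩
  set g : ℝ := (γ * ς ^ (γ - 1) * Real.exp s - N t₀ / ς ^ 2) / ς with hg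
  have hg0 : 0 < g := div_pos hgap hς
  have hf2 : f' (0, 1) = g := by
    have h1 : HasDerivAt (fun r : ℝ => f (t₀, r)) (f' (0, 1)) ς :=
      hf'.hasFDerivAt.comp_hasDerivAt ς ((hasDerivAt_const ς t₀).prodMk (hasDerivAt_id ς))
    exact h1.unique (hasDerivAt_bernoulli hγ hς (q t₀) (z t₀) s 0)
  -- Subsonicity is precisely the nondegeneracy required by the implicit function theorem.
  have hinv : (f' ∘L .inr ℝ ℝ ℝ).IsInvertible :=
    ⟨ContinuousLinearEquiv.unitsEquivAut ℝ (Units.mk0 g hg0.ne'), by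
      ext; simp [hf2]⟩
  set ψ := hf'.implicitFunctionOfProdDomain hinv with hψ
  have hψd : HasDerivAt ψ (deriv ψ t₀) t₀ :=
    (hf'.hasStrictFDerivAt_implicitFunctionOfProdDomain hinv).hasFDerivAt.differentiableAt.hasDerivAt
  have hψt : Tendsto ψ (𝓝 t₀) (𝓝 ς) := hf'.tendsto_implicitFunctionOfProdDomain hinv
  have hψ0 : ψ t₀ = ς := tendsto_nhds_unique hψd.continuousAt.tendsto hψt
  have hroot : ∀ᶠ t in 𝓝 t₀, f (t, ψ t) = 0 := by
    have := hf'.eventually_apply_implicitFunctionOfProdDomain hinv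
    filter_upwards [this] with t ht
    exact ht.trans h0
  have hpos : ∀ᶠ t in 𝓝 t₀, 0 < ψ t := hψt.eventually (lt_mem_nhds hς)
  have hgapev : ∀ᶠ t in 𝓝 t₀, 0 < γ * ψ t ^ (γ - 1) * Real.exp s - N t / ψ t ^ 2 := by
    have hc : ContinuousAt (fun t => γ * ψ t ^ (γ - 1) * Real.exp s - N t / ψ t ^ 2) t₀ := by
      have c1 : ContinuousAt (fun t => ψ t ^ (γ - 1)) t₀ :=
        hψd.continuousAt.rpow_const (Or.inl (by rw [hψ0]; exact hς.ne'))
      refine ((continuousAt_const.mul c1).mul continuousAt_const).sub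
        (hN.hasDerivAt.continuousAt.div (hψd.continuousAt.pow 2) ?_)
      rw [hψ0]; positivity
    refine hc.eventually (lt_mem_nhds ?_)
    simpa only [hψ0] using hgap
  -- Positivity of the root and of the gap are open conditions, so near t₀ the implicit function is
  -- a subsonic root, and uniqueness of that root identifies it with `density`.
  have heq : ψ =ᶠ[𝓝 t₀] fun t => density γ (q t) (z t) s 0 := by
    filter_upwards [hroot, hpos, hgapev] with t h1 h2 h3
    exact (density_eq hγ ((isSubsonicRoot_iff hγ _ _ _ _).2 ⟨h2, h1, h3⟩)).symm
  have hd : HasDerivAt (fun t => f (t, ψ t)) (f' (1, deriv ψ t₀)) t₀ := by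
    have hf'' : HasFDerivAt f f' (t₀, ψ t₀) := by rw [hψ0]; exact hf'.hasFDerivAt
    exact hf''.comp_hasDerivAt t₀ ((hasDerivAt_id t₀).prodMk hψd)
  have hd0 : f' (1, deriv ψ t₀) = 0 :=
    hd.unique ((hasDerivAt_const t₀ (0 : ℝ)).congr_of_eventuallyEq hroot)
  have hf1 : f' (1, 0) = N' / (2 * ς ^ 2) + z' := by
    have h1 : HasDerivAt (fun t : ℝ => f (t, ς)) (f' (1, 0)) t₀ :=
      hf'.hasFDerivAt.comp_hasDerivAt (f := fun t => (t, ς)) t₀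
        ((hasDerivAt_id t₀).prodMk (hasDerivAt_const t₀ ς))
    refine h1.unique ?_
    exact (((hN.hasDerivAt.div_const (2 * ς ^ 2)).add_const
      (γ * ς ^ (γ - 1) * Real.exp s / (γ - 1))).add hz.hasDerivAt).sub_const 0
  have hsplit : f' (1, deriv ψ t₀) = f' (1, 0) + deriv ψ t₀ * f' (0, 1) := by
    have : ((1 : ℝ), deriv ψ t₀) = (1, 0) + deriv ψ t₀ • ((0 : ℝ), (1 : ℝ)) := by simp
    rw [this, map_add, map_smul, smul_eq_mul]
  refine (hψd.congr_of_eventuallyEq heq.symm).congr_deriv ?_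
  rw [hsplit, hf1, hf2] at hd0
  have : deriv ψ t₀ = -(N' / (2 * ς ^ 2) + z') / g := by
    rw [eq_div_iff hg0.ne']; linarith
  rw [this, hg, div_div_eq_mul_div]

/-! ### Background flows -/

namespace BackgroundData

variable (D : BackgroundData)

theorem gradPsi₀_eq (x : ℝ × ℝ) : D.gradPsi₀ x = ![0, D.m₀] := by
  have h : HasFDerivAt D.psi₀ (D.m₀ • ContinuousLinearMap.snd ℝ ℝ ℝ) x :=
    (hasFDerivAt_snd.add_const 1).const_mul D.m₀
  funext i
  fin_cases i <;> simp [gradPsi₀, partialD, h.fderiv, basisVec]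

/-- After multiplication by r² the gap is γ e^{S₀} r^{γ+1} - m₀², which increases in r and vanishes
at the critical density. -/
theorem sonicGap_pos (hγ : 1 < D.γ) {r : ℝ} (hr : D.criticalDensity < r) :
    0 < D.sonicGap r := by
  have hk : 0 < D.γ * Real.exp D.S₀ := by positivity
  have hm : 0 ≤ D.m₀ ^ 2 / (D.γ * Real.exp D.S₀) := by positivity
  have hc : 0 ≤ D.criticalDensity := Real.rpow_nonneg hm _
  have hr0 : 0 < r := hc.trans_lt hr
  have h1 : D.criticalDensity ^ (D.γ + 1) < r ^ (D.γ + 1) :=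
    Real.rpow_lt_rpow hc hr (by linarith)
  rw [criticalDensity, one_div, Real.rpow_inv_rpow hm (by linarith)] at h1
  have h2 : r ^ (D.γ + 1) = r ^ (D.γ - 1) * r ^ 2 := by
    rw [← Real.rpow_natCast r 2, ← Real.rpow_add hr0]
    congr 1; push_cast; ring
  rw [h2, div_lt_iff₀ hk] at h1
  rw [sonicGap, sub_pos, div_lt_iff₀ (by positivity)]
  linarith

variable {D} {ρ G : ℝ → ℝ}

namespace IsBackground

theorem continuousOn_density (h : D.IsBackground ρ G) : ContinuousOn ρ (Icc 0 D.L) :=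
  fun t ht => (h.density_ode t ht).continuousWithinAt

theorem continuousOn_field (h : D.IsBackground ρ G) : ContinuousOn G (Icc 0 D.L) :=
  fun t ht => (h.field_ode t ht).continuousWithinAt

/-- The density starts above the critical value and, being continuous, would have to attain it in
order to drop below. -/
theorem critical_lt (h : D.IsBackground ρ G) (hρ₀ : D.criticalDensity < D.ρ₀) {t : ℝ}
    (ht : t ∈ Icc 0 D.L) : D.criticalDensity < ρ t := by
  by_contra! hlt
  have hsub : Icc 0 t ⊆ Icc 0 D.L := Icc_subset_Icc_right ht.2
  obtain ⟨s, hs, hs'⟩ := intermediate_value_Icc' ht.1 (h.continuousOn_density.mono hsub)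
    ⟨hlt, h.init_density ▸ hρ₀.le⟩
  exact h.density_ne s (hsub hs) hs'

theorem sonicGap_pos (h : D.IsBackground ρ G) (hγ : 1 < D.γ) (hρ₀ : D.criticalDensity < D.ρ₀)
    {t : ℝ} (ht : t ∈ Icc 0 D.L) : 0 < D.sonicGap (ρ t) :=
  D.sonicGap_pos hγ (h.critical_lt hρ₀ ht)

theorem continuousOn_sonicGap (h : D.IsBackground ρ G) :
    ContinuousOn (fun t => D.sonicGap (ρ t)) (Icc 0 D.L) := by
  have hρ := h.continuousOn_density
  refine (continuousOn_const.mul (hρ.rpow_const fun t ht => Or.inl (h.density_pos t ht).ne')).sub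
    (continuousOn_const.div (hρ.pow 2) fun t ht => pow_ne_zero 2 (h.density_pos t ht).ne')

/-- The Bernoulli law along the background flow. -/
theorem bernoulli_eq (h : D.IsBackground ρ G) (hγ : 1 < D.γ) (hρ₀ : D.criticalDensity < D.ρ₀)
    {t : ℝ} (ht : t ∈ Icc 0 D.L) :
    bernoulli D.γ (ρ t) ![0, D.m₀] (∫ s in (0 : ℝ)..t, G s) D.S₀ 0 =
      bernoulli D.γ D.ρ₀ ![0, D.m₀] 0 D.S₀ 0 := by
  have hsub : Icc 0 t ⊆ Icc 0 D.L := Icc_subset_Icc_right ht.2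
  set e : ℝ → ℝ := fun r => bernoulli D.γ r ![0, D.m₀] 0 D.S₀ 0 with he
  -- By the chain rule the derivative of `e ∘ ρ` is (gap/ρ)·ρ', which the density equation turns
  -- into -G.
  have hed : ∀ s ∈ Icc 0 D.L, HasDerivWithinAt (fun s => -e (ρ s)) (G s) (Icc 0 D.L) s := by
    intro s hs
    have h1 := ((hasDerivAt_bernoulli hγ (h.density_pos s hs) ![0, D.m₀] 0 D.S₀ 0).comp_hasDerivWithinAt
      s (h.density_ode s hs)).neg
    refine h1.congr_deriv ?_
    have hg : D.γ * ρ s ^ (D.γ - 1) * Real.exp D.S₀ - (∑ i, ![0, D.m₀] i ^ 2) / ρ s ^ 2 =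
        D.sonicGap (ρ s) := by
      simp [sonicGap]; ring
    rw [hg]
    have := (h.sonicGap_pos hγ hρ₀ hs).ne'
    have := (h.density_pos s hs).ne'
    field_simp
  have hint : ∫ s in (0 : ℝ)..t, G s = -e (ρ t) - -e (ρ 0) := by
    refine intervalIntegral.integral_eq_sub_of_hasDerivAt_of_le ht.1
      (fun s hs => ((hed s (hsub hs)).continuousWithinAt).mono hsub) (fun s hs => ?_) ?_
    · exact (hed s (hsub (Ioo_subset_Icc_self hs))).hasDerivAt
        (Icc_mem_nhds hs.1 (hs.2.trans_le ht.2))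
    · exact ((h.continuousOn_field.mono hsub).intervalIntegrable_of_Icc ht.1)
  rw [h.init_density] at hint
  have : bernoulli D.γ (ρ t) ![0, D.m₀] (∫ s in (0 : ℝ)..t, G s) D.S₀ 0 =
      e (ρ t) + ∫ s in (0 : ℝ)..t, G s := by
    simp only [he, bernoulli]; ring
  rw [this, hint]
  ring

/-- This identifies the value of Q on the background with ρ̄. The constant subtracted in `Phi₀` is
the Bernoulli value at the entrance, so the conserved quantity is normalised to zero. -/
theorem isSubsonicRoot (h : D.IsBackground ρ G) (hγ : 1 < D.γ) (hρ₀ : D.criticalDensity < D.ρ₀)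
    {x : ℝ × ℝ} (hx : x.1 ∈ Icc 0 D.L) :
    IsSubsonicRoot D.γ (D.gradPsi₀ x) (D.Phi₀ G x) D.S₀ 0 (ρ x.1) := by
  rw [isSubsonicRoot_iff hγ, gradPsi₀_eq]
  refine ⟨h.density_pos _ hx, ?_, ?_⟩
  · have h1 := h.bernoulli_eq hγ hρ₀ hx
    simp only [bernoulli, Phi₀, Fin.sum_univ_two, Matrix.cons_val_zero, Matrix.cons_val_one] at h1 ⊢
    have e1 : D.γ * Real.exp D.S₀ * D.ρ₀ ^ (D.γ - 1) = D.γ * D.ρ₀ ^ (D.γ - 1) * Real.exp D.S₀ := by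
      ring
    rw [e1]
    simp only [ne_eq, OfNat.ofNat_ne_zero, not_false_eq_true, zero_pow, zero_add] at h1 ⊢
    linarith
  · have h1 := h.sonicGap_pos hγ hρ₀ hx
    simp only [sonicGap, Fin.sum_univ_two, Matrix.cons_val_zero, Matrix.cons_val_one] at h1 ⊢
    convert h1 using 2 <;> ring

theorem init_le_field (h : D.IsBackground ρ G) (hL : 0 < D.L) {t : ℝ} (ht : t ∈ Icc 0 D.L) :
    D.G₀ ≤ G t := by
  have hm : MonotoneOn G (Icc 0 D.L) := by
    refine monotoneOn_of_hasDerivWithinAt_nonneg (convex_Icc 0 D.L) h.continuousOn_field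
      (f' := ρ) (fun s hs => ?_) fun s hs => ?_
    · exact (h.field_ode s (interior_subset hs)).mono interior_subset
    · exact (h.density_pos s (interior_subset hs)).le
  exact h.init_field ▸ hm (left_mem_Icc.2 hL.le) ht ht.1

end IsBackground

/-- Background densities are bounded in terms of the data alone. -/
theorem exists_density_bound (D : BackgroundData) (hγ : 1 < D.γ)
    (hρ₀ : D.criticalDensity < D.ρ₀) (hL : 0 < D.L) :
    ∃ M > 0, ∀ ρ G : ℝ → ℝ, D.IsBackground ρ G → ∀ t ∈ Icc 0 D.L, ρ t ≤ M := by
  -- K bounds the enthalpy term: the kinetic term is nonnegative and ∫ G ≥ -|G₀| L because G ≥ G₀.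
  -- Below, the maximum with 1 only makes the bound positive.
  set K := |bernoulli D.γ D.ρ₀ ![0, D.m₀] 0 D.S₀ 0| + |D.G₀| * D.L with hK
  have hγ1 : 0 < D.γ - 1 := by linarith
  have hk : 0 < D.γ * Real.exp D.S₀ := by positivity
  have hK0 : 0 ≤ K := by positivity
  refine ⟨max 1 ((K * (D.γ - 1) / (D.γ * Real.exp D.S₀)) ^ (D.γ - 1)⁻¹), by positivity,
    fun ρ G h t ht => le_max_of_le_right ?_⟩
  have hpos := h.density_pos t ht
  rw [Real.le_rpow_inv_iff_of_pos hpos.le (by positivity) hγ1, le_div_iff₀ hk]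
  have hsub : Icc 0 t ⊆ Icc 0 D.L := Icc_subset_Icc_right ht.2
  have h1 := h.bernoulli_eq hγ hρ₀ ht
  have h2 : -(|D.G₀| * D.L) ≤ ∫ s in (0 : ℝ)..t, G s := by
    have : ∫ _ in (0 : ℝ)..t, D.G₀ ≤ ∫ s in (0 : ℝ)..t, G s :=
      intervalIntegral.integral_mono_on ht.1 (by simp)
        ((h.continuousOn_field.mono hsub).intervalIntegrable_of_Icc ht.1)
        fun s hs => h.init_le_field hL (hsub hs)
    rw [intervalIntegral.integral_const, smul_eq_mul, sub_zero] at this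
    have h3 : |D.G₀| * t ≤ |D.G₀| * D.L := by gcongr; exact ht.2
    have h4 : -(t * |D.G₀|) ≤ t * D.G₀ := by
      rw [← mul_neg]; exact mul_le_mul_of_nonneg_left (neg_abs_le _) ht.1
    linarith
  have h3 : D.γ * ρ t ^ (D.γ - 1) * Real.exp D.S₀ / (D.γ - 1) ≤ K := by
    have h4 : D.γ * ρ t ^ (D.γ - 1) * Real.exp D.S₀ / (D.γ - 1) + ∫ s in (0 : ℝ)..t, G s ≤
        bernoulli D.γ (ρ t) ![0, D.m₀] (∫ s in (0 : ℝ)..t, G s) D.S₀ 0 := by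
      have : 0 ≤ (∑ i, ![0, D.m₀] i ^ 2) / (2 * ρ t ^ 2) := by positivity
      simp only [bernoulli] at this ⊢
      linarith
    have := le_abs_self (bernoulli D.γ D.ρ₀ ![0, D.m₀] 0 D.S₀ 0)
    linarith
  rw [div_le_iff₀ hγ1] at h3
  linarith

/-! ### Explicit coefficients -/

theorem sonicGap_eq (D : BackgroundData) (r : ℝ) (x : ℝ × ℝ) : 
    D.γ * r ^ (D.γ - 1) * Real.exp D.S₀ - (∑ i, D.gradPsi₀ x i ^ 2) / r ^ 2 = D.sonicGap r := by
  simp [gradPsi₀_eq, sonicGap]; ring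

namespace IsBackground

theorem hasDerivAt_density_grad (h : D.IsBackground ρ G) (hγ : 1 < D.γ)
    (hρ₀ : D.criticalDensity < D.ρ₀) {x : ℝ × ℝ} (hx : x.1 ∈ Icc 0 D.L) (i : Fin 2) :
    HasDerivAt (fun t => density D.γ (Function.update (D.gradPsi₀ x) i t) (D.Phi₀ G x) D.S₀ 0)
      (-D.gradPsi₀ x i / (ρ x.1 * D.sonicGap (ρ x.1))) (D.gradPsi₀ x i) := by
  have hroot := h.isSubsonicRoot hγ hρ₀ hx
  have hN : HasStrictDerivAt (fun t => ∑ j, Function.update (D.gradPsi₀ x) i t j ^ 2)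
      (2 * D.gradPsi₀ x i) (D.gradPsi₀ x i) := by
    have h2 : HasStrictDerivAt (fun t : ℝ => t ^ 2) (2 * D.gradPsi₀ x i) (D.gradPsi₀ x i) := by
      simpa using hasStrictDerivAt_pow 2 (D.gradPsi₀ x i)
    fin_cases i
    · simpa [Fin.sum_univ_two] using h2.add_const (D.gradPsi₀ x 1 ^ 2)
    · simpa [Fin.sum_univ_two] using h2.const_add (D.gradPsi₀ x 0 ^ 2)
  have key := hasDerivAt_density (s := D.S₀) (ς := ρ x.1) hγ hN
    (hasStrictDerivAt_const _ (D.Phi₀ G x)) (by simpa using hroot)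
  refine key.congr_deriv ?_
  rw [Function.update_eq_self, D.sonicGap_eq]
  have := (h.density_pos _ hx).ne'
  have := (h.sonicGap_pos hγ hρ₀ hx).ne'
  field_simp
  ring

theorem hasDerivAt_density_potential (h : D.IsBackground ρ G) (hγ : 1 < D.γ)
    (hρ₀ : D.criticalDensity < D.ρ₀) {x : ℝ × ℝ} (hx : x.1 ∈ Icc 0 D.L) :
    HasDerivAt (fun z => density D.γ (D.gradPsi₀ x) z D.S₀ 0)
      (-ρ x.1 / D.sonicGap (ρ x.1)) (D.Phi₀ G x) := by
  have key := hasDerivAt_density (s := D.S₀) (ς := ρ x.1) hγ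
    (hasStrictDerivAt_const _ (∑ i, D.gradPsi₀ x i ^ 2)) (hasStrictDerivAt_id (D.Phi₀ G x))
    (h.isSubsonicRoot hγ hρ₀ hx)
  refine key.congr_deriv ?_
  rw [D.sonicGap_eq]
  ring

theorem coefA_diag (h : D.IsBackground ρ G) (hγ : 1 < D.γ)
    (hρ₀ : D.criticalDensity < D.ρ₀) {x : ℝ × ℝ} (hx : x.1 ∈ Icc 0 D.L) (i : Fin 2) : D.coefA G i i x =
    1 / ρ x.1 + D.gradPsi₀ x i ^ 2 / (ρ x.1 ^ 3 * D.sonicGap (ρ x.1)) := by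
  have hQ := density_eq hγ (h.isSubsonicRoot hγ hρ₀ hx)
  have hρ := (h.density_pos _ hx).ne'
  have key := (hasDerivAt_id (D.gradPsi₀ x i)).div (h.hasDerivAt_density_grad hγ hρ₀ hx i)
    (by rw [Function.update_eq_self, hQ]; exact hρ)
  have e : (fun t => fluxA D.γ i (Function.update (D.gradPsi₀ x) i t) (D.Phi₀ G x) D.S₀) =
      id / fun t => density D.γ (Function.update (D.gradPsi₀ x) i t) (D.Phi₀ G x) D.S₀ 0 := by
    funext t; simp [fluxA]
  rw [coefA, e, key.deriv, Function.update_eq_self, hQ]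
  have := (h.sonicGap_pos hγ hρ₀ hx).ne'
  simp only [id]
  field_simp
  ring

theorem coefB_eq (h : D.IsBackground ρ G) (hγ : 1 < D.γ)
    (hρ₀ : D.criticalDensity < D.ρ₀) {x : ℝ × ℝ} (hx : x.1 ∈ Icc 0 D.L) (i : Fin 2) : D.coefB G i x =
    D.gradPsi₀ x i / (ρ x.1 * D.sonicGap (ρ x.1)) := by
  have hQ := density_eq hγ (h.isSubsonicRoot hγ hρ₀ hx)
  have hρ := (h.density_pos _ hx).ne'
  have key := (hasDerivAt_const (D.Phi₀ G x) (D.gradPsi₀ x i)).div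
    (h.hasDerivAt_density_potential hγ hρ₀ hx) (by rw [hQ]; exact hρ)
  have e : (fun z => fluxA D.γ i (D.gradPsi₀ x) z D.S₀) =
      (fun _ => D.gradPsi₀ x i) / fun z => density D.γ (D.gradPsi₀ x) z D.S₀ 0 := by
    funext t; simp [fluxA]
  rw [coefB, e, key.deriv, hQ]
  have := (h.sonicGap_pos hγ hρ₀ hx).ne'
  field_simp
  ring

/-- The value is opposite to that of `coefB_eq`; this antisymmetry removes the mixed terms from the
energy. -/
theorem coefC_eq (h : D.IsBackground ρ G) (hγ : 1 < D.γ)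
    (hρ₀ : D.criticalDensity < D.ρ₀) {x : ℝ × ℝ} (hx : x.1 ∈ Icc 0 D.L) (i : Fin 2) : D.coefC G i x =
    -D.gradPsi₀ x i / (ρ x.1 * D.sonicGap (ρ x.1)) :=
  (h.hasDerivAt_density_grad hγ hρ₀ hx i).deriv

theorem coefD_eq (h : D.IsBackground ρ G) (hγ : 1 < D.γ)
    (hρ₀ : D.criticalDensity < D.ρ₀) {x : ℝ × ℝ} (hx : x.1 ∈ Icc 0 D.L) : D.coefD G x = -ρ x.1 / D.sonicGap (ρ x.1) :=
  (h.hasDerivAt_density_potential hγ hρ₀ hx).deriv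

end IsBackground

end BackgroundData

/-! ### One dimensional inequalities -/

/-- Cauchy–Schwarz, from nonnegativity of the variance of g about its mean. -/
theorem sq_intervalIntegral_le {a b : ℝ} (hab : a ≤ b) {g : ℝ → ℝ} (hg : Continuous g) :
    (∫ x in a..b, g x) ^ 2 ≤ (b - a) * ∫ x in a..b, g x ^ 2 := by
  rcases hab.eq_or_lt with rfl | hlt
  · simp
  set m := (∫ x in a..b, g x) / (b - a) with hm
  have hba : 0 < b - a := sub_pos.2 hlt
  have h0 : 0 ≤ ∫ x in a..b, (g x - m) ^ 2 :=
    intervalIntegral.integral_nonneg hab fun x _ => sq_nonneg _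
  have h1 : ∫ x in a..b, (g x - m) ^ 2 =
      (∫ x in a..b, g x ^ 2) - 2 * m * (∫ x in a..b, g x) + (b - a) * m ^ 2 := by
    have e : ∀ x, (g x - m) ^ 2 = g x ^ 2 - 2 * m * g x + m ^ 2 := fun x => by ring
    simp_rw [e]
    rw [intervalIntegral.integral_add, intervalIntegral.integral_sub,
      intervalIntegral.integral_const_mul, intervalIntegral.integral_const, smul_eq_mul]
    all_goals exact Continuous.intervalIntegrable (by fun_prop) _ _
  have h2 : (∫ x in a..b, g x) = m * (b - a) := by rw [hm, div_mul_cancel₀ _ hba.ne']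
  rw [h1, h2] at h0
  rw [h2]
  nlinarith

/-- Writing f(L) - f(x) as an integral over [x, L] gives the pointwise factor L - x, whose integral
is L²/2. This constant is the one built into the smallness condition. -/
theorem integral_sub_right_sq_le {L : ℝ} (hL : 0 < L) {f f' : ℝ → ℝ}
    (hf : ∀ x, HasDerivAt f (f' x) x) (hf' : Continuous f') :
    ∫ x in (0 : ℝ)..L, (f x - f L) ^ 2 ≤ L ^ 2 / 2 * ∫ x in (0 : ℝ)..L, f' x ^ 2 := by
  have hfc : Continuous f := continuous_iff_continuousAt.2 fun x => (hf x).continuousAt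
  set A := ∫ x in (0 : ℝ)..L, f' x ^ 2 with hA
  have hpt : ∀ x ∈ Icc 0 L, (f x - f L) ^ 2 ≤ (L - x) * A := by
    intro x hx
    have h1 : ∫ y in x..L, f' y = f L - f x :=
      intervalIntegral.integral_eq_sub_of_hasDerivAt (fun y _ => hf y) (hf'.intervalIntegrable _ _)
    have h2 := sq_intervalIntegral_le hx.2 hf'
    have h3 : ∫ y in x..L, f' y ^ 2 ≤ A := by
      have hi : ∀ c d, IntervalIntegrable (fun y => f' y ^ 2) volume c d := fun c d =>
        Continuous.intervalIntegrable (by fun_prop) c d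
      rw [hA, ← intervalIntegral.integral_add_adjacent_intervals (hi 0 x) (hi x L)]
      have : 0 ≤ ∫ y in (0 : ℝ)..x, f' y ^ 2 :=
        intervalIntegral.integral_nonneg hx.1 fun _ _ => sq_nonneg _
      linarith
    have h4 := mul_le_mul_of_nonneg_left h3 (sub_nonneg.2 hx.2)
    rw [h1] at h2
    linarith [sq_abs (f x - f L), show (f x - f L) ^ 2 = (f L - f x) ^ 2 by ring]
  calc ∫ x in (0 : ℝ)..L, (f x - f L) ^ 2 ≤ ∫ x in (0 : ℝ)..L, (L - x) * A :=
        intervalIntegral.integral_mono_on hL.le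
          (Continuous.intervalIntegrable (by fun_prop) _ _)
          (Continuous.intervalIntegrable (by fun_prop) _ _) hpt
    _ = L ^ 2 / 2 * A := by
        rw [intervalIntegral.integral_mul_const, intervalIntegral.integral_sub (by simp) (by simp)]
        rw [intervalIntegral.integral_const, integral_id, smul_eq_mul]
        ring

/-- The cutoff 1 - x/L equals 1 at the left end and 0 at the right end, so -f(0) is the integral of
the derivative of the product, and Cauchy–Schwarz applies. -/
theorem left_endpoint_sq_le {L : ℝ} (hL : 0 < L) {f f' : ℝ → ℝ}
    (hf : ∀ x, HasDerivAt f (f' x) x) (hf' : Continuous f') :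
    f 0 ^ 2 ≤ ∫ x in (0 : ℝ)..L, (2 * L * f' x ^ 2 + 2 / L * f x ^ 2) := by
  have hfc : Continuous f := continuous_iff_continuousAt.2 fun x => (hf x).continuousAt
  set g : ℝ → ℝ := fun x => (1 - x / L) * f' x - f x / L with hg
  have hgc : Continuous g := by fun_prop
  have hd : ∀ x, HasDerivAt (fun x => (1 - x / L) * f x) (g x) x := by
    intro x
    have h1 : HasDerivAt (fun x => 1 - x / L) (-(1 / L)) x :=
      ((hasDerivAt_id x).div_const L).const_sub 1
    refine (h1.mul (hf x)).congr_deriv ?_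
    simp only [hg]; ring
  have h1 : ∫ x in (0 : ℝ)..L, g x = -f 0 := by
    rw [intervalIntegral.integral_eq_sub_of_hasDerivAt (fun y _ => hd y)
      (hgc.intervalIntegrable _ _)]
    simp [hL.ne']
  have h2 := sq_intervalIntegral_le hL.le hgc
  rw [h1, ← intervalIntegral.integral_const_mul] at h2
  have e : f 0 ^ 2 = (-f 0) ^ 2 := by ring
  rw [e]
  refine h2.trans (intervalIntegral.integral_mono_on hL.le
    (Continuous.intervalIntegrable (by fun_prop) _ _)
    (Continuous.intervalIntegrable (by fun_prop) _ _) fun x hx => ?_)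
  have hχ : (1 - x / L) ^ 2 ≤ 1 := by
    have h3 : 0 ≤ x / L := div_nonneg hx.1 hL.le
    have h4 : x / L ≤ 1 := (div_le_one hL).2 hx.2
    nlinarith
  have h5 : g x ^ 2 ≤ 2 * f' x ^ 2 + 2 * (f x / L) ^ 2 := by
    have h6 : (1 - x / L) ^ 2 * f' x ^ 2 ≤ 1 * f' x ^ 2 := by gcongr
    have h7 := sq_nonneg ((1 - x / L) * f' x + f x / L)
    simp only [hg]
    nlinarith
  have h8 := mul_le_mul_of_nonneg_left h5 (sub_nonneg.2 hL.le)
  refine h8.trans (le_of_eq ?_)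
  field_simp
  ring

/-! ### Integration over the duct -/

theorem measurableSet_duct (L : ℝ) : MeasurableSet (duct L) :=
  measurableSet_Ioo.prod measurableSet_Ioo

theorem ductMeasure_eq_prod (L : ℝ) : ductMeasure L =
    (volume.restrict (Ioo 0 L)).prod (volume.restrict (Ioo (-1) 1)) := by
  rw [Measure.prod_restrict, ductMeasure, duct, Measure.volume_eq_prod]

theorem duct_subset (L : ℝ) : duct L ⊆ Icc 0 L ×ˢ Icc (-1) 1 :=
  prod_mono Ioo_subset_Icc_self Ioo_subset_Icc_self

theorem isCompact_box (L : ℝ) : IsCompact (Icc 0 L ×ˢ Icc (-1 : ℝ) 1) :=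
  isCompact_Icc.prod isCompact_Icc

theorem closure_duct {L : ℝ} (hL : 0 < L) : closure (duct L) = Icc 0 L ×ˢ Icc (-1) 1 := by
  rw [duct, closure_prod_eq, closure_Ioo hL.ne, closure_Ioo (by norm_num)]

instance isFiniteMeasure_ductMeasure (L : ℝ) : IsFiniteMeasure (ductMeasure L) :=
  ⟨by
    rw [ductMeasure, Measure.restrict_apply_univ]
    exact (measure_mono (duct_subset L)).trans_lt (isCompact_box L).measure_lt_top⟩

theorem memLp_of_continuousOn_compact {X : Type*} [TopologicalSpace X] [MeasurableSpace X]
    [OpensMeasurableSpace X] [SecondCountableTopology X] {μ : Measure X} {s K : Set X}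
    [IsFiniteMeasure (μ.restrict s)] (hs : MeasurableSet s)
    (hK : IsCompact K) (hsK : s ⊆ K) {f : X → ℝ} (hf : ContinuousOn f K) :
    MemLp f 2 (μ.restrict s) := by
  obtain ⟨C, hC⟩ := hK.exists_bound_of_continuousOn hf
  refine MemLp.of_bound ((hf.mono hsK).aestronglyMeasurable hs) C ?_
  filter_upwards [ae_restrict_mem hs] with x hx using hC x (hsK hx)

theorem memLp_duct {L : ℝ} {f : ℝ × ℝ → ℝ} (hf : Continuous f) : MemLp f 2 (ductMeasure L) :=
  memLp_of_continuousOn_compact (measurableSet_duct L) (isCompact_box L) (duct_subset L)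
    hf.continuousOn

theorem memLp_Ioo {a b : ℝ} {f : ℝ → ℝ} (hf : Continuous f) :
    MemLp f 2 (volume.restrict (Ioo a b)) :=
  memLp_of_continuousOn_compact measurableSet_Ioo isCompact_Icc Ioo_subset_Icc_self
    hf.continuousOn

theorem integrable_duct {L : ℝ} {f : ℝ × ℝ → ℝ} (hf : Continuous f) :
    Integrable f (ductMeasure L) :=
  (memLp_duct hf).integrable one_le_two

theorem integral_duct {L : ℝ} (hL : 0 < L) {f : ℝ × ℝ → ℝ} (hf : Continuous f) :
    ∫ x in duct L, f x = ∫ t in Ioo (-1 : ℝ) 1, ∫ s in (0 : ℝ)..L, f (s, t) := by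
  have hi := integrable_duct (L := L) hf
  change ∫ x, f x ∂(ductMeasure L) = _
  rw [ductMeasure_eq_prod] at hi ⊢
  rw [integral_prod_symm _ hi]
  refine integral_congr_ae (Eventually.of_forall fun t => ?_)
  simp only
  rw [intervalIntegral.integral_of_le hL.le, integral_Ioc_eq_integral_Ioo]

theorem continuous_inner_integral {L : ℝ} {f : ℝ × ℝ → ℝ} (hf : Continuous f) :
    Continuous fun t => ∫ s in (0 : ℝ)..L, f (s, t) :=
  intervalIntegral.continuous_parametric_intervalIntegral_of_continuous'
    (f := fun t s => f (s, t)) (hf.comp continuous_swap) _ _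

theorem integral_Ioo_le_integral_duct {L : ℝ} (hL : 0 < L) {τ : ℝ → ℝ} {f : ℝ × ℝ → ℝ}
    (hτ : Continuous τ) (hf : Continuous f) (h : ∀ t, τ t ≤ ∫ s in (0 : ℝ)..L, f (s, t)) :
    ∫ t in Ioo (-1 : ℝ) 1, τ t ≤ ∫ x in duct L, f x := by
  rw [integral_duct hL hf]
  exact integral_mono ((memLp_Ioo hτ).integrable one_le_two)
    ((memLp_Ioo (continuous_inner_integral hf)).integrable one_le_two) h

/-! ### Inequalities for smooth functions on the duct -/

theorem continuous_partialD {φ : ℝ × ℝ → ℝ} (hφ : ContDiff ℝ ∞ φ) (i : Fin 2) :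
    Continuous (partialD i φ) :=
  (hφ.continuous_fderiv (by simp)).clm_apply continuous_const

theorem hasDerivAt_partialD_zero {φ : ℝ × ℝ → ℝ} (hφ : ContDiff ℝ ∞ φ) (s t : ℝ) :
    HasDerivAt (fun s => φ (s, t)) (partialD 0 φ (s, t)) s :=
  ((hφ.differentiable (by simp)) (s, t)).hasFDerivAt.comp_hasDerivAt (f := fun s => (s, t)) s
    ((hasDerivAt_id s).prodMk (hasDerivAt_const s t))

/-- The exit value is subtracted because smooth approximants of a function with zero exit trace need
not vanish on the exit themselves. -/
theorem integral_sub_exit_sq_le {L : ℝ} (hL : 0 < L) {φ : ℝ × ℝ → ℝ} (hφ : ContDiff ℝ ∞ φ) :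
    ∫ x in duct L, (φ x - φ (L, x.2)) ^ 2 ≤ L ^ 2 / 2 * ∫ x in duct L, partialD 0 φ x ^ 2 := by
  have hc := hφ.continuous
  have hp := continuous_partialD hφ 0
  have hw : Continuous fun x : ℝ × ℝ => (φ x - φ (L, x.2)) ^ 2 := by fun_prop
  rw [integral_duct hL hw, ← integral_const_mul]
  refine integral_Ioo_le_integral_duct hL (continuous_inner_integral hw) (by fun_prop) fun t => ?_
  rw [intervalIntegral.integral_const_mul]
  exact integral_sub_right_sq_le hL (hasDerivAt_partialD_zero hφ · t) (by fun_prop)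

theorem integral_entrance_sq_le {L : ℝ} (hL : 0 < L) {φ : ℝ × ℝ → ℝ} (hφ : ContDiff ℝ ∞ φ) :
    ∫ t in Ioo (-1 : ℝ) 1, φ (0, t) ^ 2 ≤
      2 * L * (∫ x in duct L, partialD 0 φ x ^ 2) + 2 / L * ∫ x in duct L, φ x ^ 2 := by
  have hc := hφ.continuous
  have hp := continuous_partialD hφ 0
  rw [← integral_const_mul, ← integral_const_mul, ← integral_add
    (integrable_duct (by fun_prop)) (integrable_duct (by fun_prop))]
  refine integral_Ioo_le_integral_duct hL (by fun_prop) (by fun_prop) fun t => ?_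
  exact left_endpoint_sq_le hL (hasDerivAt_partialD_zero hφ · t) (by fun_prop)

theorem integral_duct_exit_sq {L : ℝ} (hL : 0 < L) {φ : ℝ × ℝ → ℝ} (hφ : Continuous φ) :
    ∫ x in duct L, φ (L, x.2) ^ 2 = L * ∫ t in Ioo (-1 : ℝ) 1, φ (L, t) ^ 2 := by
  rw [integral_duct hL (by fun_prop), ← integral_const_mul]
  simp

/-! ### Traces as closed graphs -/

/-- `L²(Ω_L)`. -/
abbrev DuctL2 (L : ℝ) := Lp ℝ 2 (ductMeasure L)

/-- Candidate pairs of a function and its gradient in `L²(Ω_L)`. -/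
abbrev Jet (L : ℝ) := DuctL2 L × (Fin 2 → DuctL2 L)

/-- `L²(a, b)`. -/
abbrev SegmentL2 (a b : ℝ) := Lp ℝ 2 (volume.restrict (Ioo a b))

/-- Smooth functions on the plane. -/
def smoothFns : Submodule ℝ (ℝ × ℝ → ℝ) where
  carrier := {φ | ContDiff ℝ ∞ φ}
  add_mem' {φ ψ} hφ hψ := show ContDiff ℝ ∞ (φ + ψ) from ContDiff.add hφ hψ
  zero_mem' := show ContDiff ℝ ∞ (fun _ => (0 : ℝ)) from contDiff_const
  smul_mem' c φ hφ := show ContDiff ℝ ∞ (c • φ) from ContDiff.const_smul c hφ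

theorem smoothFns.contDiff (φ : smoothFns) : ContDiff ℝ ∞ φ.1 := φ.2

theorem norm_sq_toLp {X : Type*} [MeasurableSpace X] {μ : Measure X} {f : X → ℝ}
    (hf : MemLp f 2 μ) : ‖hf.toLp f‖ ^ 2 = ∫ x, f x ^ 2 ∂μ := by
  rw [← real_inner_self_eq_norm_sq, L2.inner_def]
  refine integral_congr_ae ?_
  filter_upwards [hf.coeFn_toLp] with x hx
  simp [hx, sq]

theorem partialD_add {φ ψ : ℝ × ℝ → ℝ} (hφ : ContDiff ℝ ∞ φ) (hψ : ContDiff ℝ ∞ ψ) (i : Fin 2) :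
    partialD i (φ + ψ) = partialD i φ + partialD i ψ := by
  funext x
  simp only [partialD, Pi.add_apply]
  rw [fderiv_add (hφ.differentiable (by simp) x) (hψ.differentiable (by simp) x)]
  rfl

theorem partialD_smul {φ : ℝ × ℝ → ℝ} (hφ : ContDiff ℝ ∞ φ) (c : ℝ) (i : Fin 2) :
    partialD i (c • φ) = c • partialD i φ := by
  funext x
  simp only [partialD, Pi.smul_apply]
  rw [fderiv_const_smul (hφ.differentiable (by simp) x)]
  rfl

theorem smoothFns.memLp (L : ℝ) (φ : smoothFns) : MemLp φ.1 2 (ductMeasure L) :=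
  memLp_duct (smoothFns.contDiff φ).continuous

theorem smoothFns.memLp_partialD (L : ℝ) (φ : smoothFns) (i : Fin 2) :
    MemLp (partialD i φ.1) 2 (ductMeasure L) :=
  memLp_duct (continuous_partialD (smoothFns.contDiff φ) i)

theorem smoothFns.memLp_comp (e : C(ℝ, ℝ × ℝ)) (a b : ℝ) (φ : smoothFns) :
    MemLp (φ.1 ∘ e) 2 (volume.restrict (Ioo a b)) :=
  memLp_Ioo ((smoothFns.contDiff φ).continuous.comp e.continuous)

/-- The function and gradient of a smooth function on the duct. -/
def smoothJet (L : ℝ) : smoothFns →ₗ[ℝ] Jet L where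
  toFun φ := ((smoothFns.memLp L φ).toLp φ.1,
    fun i => (smoothFns.memLp_partialD L φ i).toLp (partialD i φ.1))
  map_add' φ ψ := by
    refine Prod.ext (MemLp.toLp_add (smoothFns.memLp L φ) (smoothFns.memLp L ψ))
      (funext fun i => ?_)
    refine Eq.trans ?_ (MemLp.toLp_add (smoothFns.memLp_partialD L φ i)
      (smoothFns.memLp_partialD L ψ i))
    exact MemLp.toLp_congr (smoothFns.memLp_partialD L (φ + ψ) i)
      ((smoothFns.memLp_partialD L φ i).add (smoothFns.memLp_partialD L ψ i))
      (Eventually.of_forall (congrFun (partialD_add (smoothFns.contDiff φ) (smoothFns.contDiff ψ) i)))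
  map_smul' c φ := by
    refine Prod.ext (MemLp.toLp_const_smul c (smoothFns.memLp L φ)) (funext fun i => ?_)
    refine Eq.trans ?_ (MemLp.toLp_const_smul c (smoothFns.memLp_partialD L φ i))
    exact MemLp.toLp_congr (smoothFns.memLp_partialD L (c • φ) i)
      ((smoothFns.memLp_partialD L φ i).const_smul c)
      (Eventually.of_forall (congrFun (partialD_smul (smoothFns.contDiff φ) c i)))

/-- The restriction of a smooth function to the segment `t ↦ e t`, `a < t < b`. -/
def smoothRestrict (e : C(ℝ, ℝ × ℝ)) (a b : ℝ) : smoothFns →ₗ[ℝ] SegmentL2 a b where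
  toFun φ := (smoothFns.memLp_comp e a b φ).toLp (φ.1 ∘ e)
  map_add' φ ψ := MemLp.toLp_add (smoothFns.memLp_comp e a b φ) (smoothFns.memLp_comp e a b ψ)
  map_smul' c φ := MemLp.toLp_const_smul c (smoothFns.memLp_comp e a b φ)

theorem norm_sq_smoothJet_fst (L : ℝ) (φ : smoothFns) :
    ‖(smoothJet L φ).1‖ ^ 2 = ∫ x in duct L, φ.1 x ^ 2 := norm_sq_toLp (smoothFns.memLp L φ)

theorem norm_sq_smoothJet_snd (L : ℝ) (φ : smoothFns) (i : Fin 2) :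
    ‖(smoothJet L φ).2 i‖ ^ 2 = ∫ x in duct L, partialD i φ.1 x ^ 2 :=
  norm_sq_toLp (smoothFns.memLp_partialD L φ i)

theorem norm_sq_smoothRestrict (e : C(ℝ, ℝ × ℝ)) (a b : ℝ) (φ : smoothFns) :
    ‖smoothRestrict e a b φ‖ ^ 2 = ∫ t in Ioo a b, φ.1 (e t) ^ 2 :=
  norm_sq_toLp (smoothFns.memLp_comp e a b φ)

/-- The closure of the graph of the restriction to the segment `e`. -/
def traceGraph (L : ℝ) (e : C(ℝ, ℝ × ℝ)) (a b : ℝ) : Submodule ℝ (Jet L × SegmentL2 a b) :=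
  (LinearMap.range ((smoothJet L).prod (smoothRestrict e a b))).topologicalClosure

theorem isClosed_traceGraph (L : ℝ) (e : C(ℝ, ℝ × ℝ)) (a b : ℝ) :
    IsClosed (traceGraph L e a b : Set (Jet L × SegmentL2 a b)) :=
  Submodule.isClosed_topologicalClosure _

/-- The density principle behind all trace inequalities: a closed property need only be checked on
smooth functions. -/
theorem traceGraph_induction {L : ℝ} {e : C(ℝ, ℝ × ℝ)} {a b : ℝ}
    {P : Jet L × SegmentL2 a b → Prop} (hP : IsClosed {w | P w})
    (h : ∀ φ : smoothFns, P (smoothJet L φ, smoothRestrict e a b φ))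
    {w : Jet L × SegmentL2 a b} (hw : w ∈ traceGraph L e a b) : P w := by
  refine closure_minimal (t := {w | P w}) ?_ hP hw
  rintro _ ⟨φ, rfl⟩
  exact h φ

/-- The function and gradient of an element of `H¹`. -/
def H1.jet {L : ℝ} (u : H1 L) : Jet L := (u.val, u.grad)

/-- Having a trace becomes membership in a closed subspace, so linearity and stability under limits
come for free. -/
theorem hasTrace_iff {L : ℝ} {u : H1 L} {e : C(ℝ, ℝ × ℝ)} {a b : ℝ} {τ : ℝ → ℝ}
    (hτ : MemLp τ 2 (volume.restrict (Ioo a b))) :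
    HasTrace u e (Ioo a b) τ ↔ (u.jet, hτ.toLp τ) ∈ traceGraph L e a b := by
  have key : ∀ φ : ℕ → smoothFns,
      (Tendsto (fun n => eLpNorm (fun x => (φ n).1 x - u.val x) 2 (ductMeasure L)) atTop (𝓝 0) ∧
      (∀ i, Tendsto (fun n => eLpNorm (fun x => partialD i (φ n).1 x - u.grad i x) 2
        (ductMeasure L)) atTop (𝓝 0)) ∧
      Tendsto (fun n => eLpNorm (fun t => (φ n).1 (e t) - τ t) 2 (volume.restrict (Ioo a b)))
        atTop (𝓝 0)) ↔
      Tendsto (fun n => (smoothJet L (φ n), smoothRestrict e a b (φ n))) atTop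
        (𝓝 (u.jet, hτ.toLp τ)) := by
    intro φ
    have h1 := Lp.tendsto_Lp_iff_tendsto_eLpNorm'' (fi := atTop) (p := 2) (μ := ductMeasure L)
      (fun n => (φ n).1) (fun n => memLp_duct (smoothFns.contDiff (φ n)).continuous) u.val (Lp.memLp u.val)
    have h2 := fun i => Lp.tendsto_Lp_iff_tendsto_eLpNorm'' (fi := atTop) (p := 2)
      (μ := ductMeasure L) (fun n => partialD i (φ n).1)
      (fun n => memLp_duct (continuous_partialD (smoothFns.contDiff (φ n)) i)) (u.grad i) (Lp.memLp (u.grad i))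
    have h3 := Lp.tendsto_Lp_iff_tendsto_eLpNorm'' (fi := atTop) (p := 2)
      (μ := volume.restrict (Ioo a b)) (fun n => (φ n).1 ∘ e)
      (fun n => memLp_Ioo ((smoothFns.contDiff (φ n)).continuous.comp e.continuous)) τ hτ
    rw [Prod.tendsto_iff, Prod.tendsto_iff, tendsto_pi_nhds, and_assoc]
    simp only [Lp.toLp_coeFn] at h1 h2
    exact and_congr h1.symm (and_congr (forall_congr' fun i => (h2 i).symm) h3.symm)
  rw [← SetLike.mem_coe, traceGraph, Submodule.topologicalClosure_coe, mem_closure_iff_seq_limit]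
  constructor
  · rintro ⟨_, φ, hφ, h⟩
    exact ⟨_, fun n => ⟨⟨φ n, hφ n⟩, rfl⟩, (key fun n => ⟨φ n, hφ n⟩).1 h⟩
  · rintro ⟨x, hx, h⟩
    choose φ hφ using hx
    have hx' : x = fun n => (smoothJet L (φ n), smoothRestrict e a b (φ n)) :=
      funext fun n => (hφ n).symm
    rw [hx'] at h
    exact ⟨hτ, fun n => (φ n).1, fun n => (φ n).2, (key φ).2 h⟩

/-- Pairs of a function and a gradient whose trace on the segment `e` vanishes. -/
def zeroTrace (L : ℝ) (e : C(ℝ, ℝ × ℝ)) (a b : ℝ) : Submodule ℝ (Jet L) :=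
  (traceGraph L e a b).comap (LinearMap.inl ℝ (Jet L) (SegmentL2 a b))

theorem isClosed_zeroTrace (L : ℝ) (e : C(ℝ, ℝ × ℝ)) (a b : ℝ) :
    IsClosed (zeroTrace L e a b : Set (Jet L)) :=
  (isClosed_traceGraph L e a b).preimage (by
    exact (continuous_id.prodMk continuous_const : Continuous fun x : Jet L => (x, (0 : SegmentL2 a b))))

theorem hasTrace_zero_iff {L : ℝ} {u : H1 L} {e : C(ℝ, ℝ × ℝ)} {a b : ℝ} :
    HasTrace u e (Ioo a b) 0 ↔ u.jet ∈ zeroTrace L e a b := by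
  rw [hasTrace_iff MemLp.zero]
  rfl

/-- The parametrization of the exit. -/
def exitMap (L : ℝ) : C(ℝ, ℝ × ℝ) := ⟨fun t => (L, t), by fun_prop⟩

/-- The parametrization of the entrance. -/
def entranceMap : C(ℝ, ℝ × ℝ) := ⟨fun t => (0, t), by fun_prop⟩

/-- The parametrization of the wall at height `h`. -/
def wallMap (h : ℝ) : C(ℝ, ℝ × ℝ) := ⟨fun t => (t, h), by fun_prop⟩

/-! ### Poincaré inequality and entrance traces -/

/-- Split φ into φ - φ(L, ·) and φ(L, ·). The boundary term makes the inequality valid for every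
smooth φ, so it survives closure; it drops out once the trace is zero. -/
theorem norm_le_exit {L : ℝ} (hL : 0 < L) {w : Jet L × SegmentL2 (-1) 1}
    (hw : w ∈ traceGraph L (exitMap L) (-1) 1) :
    ‖w.1.1‖ ≤ √(L ^ 2 / 2) * ‖w.1.2 0‖ + √L * ‖w.2‖ := by
  refine traceGraph_induction (P := fun w => ‖w.1.1‖ ≤ √(L ^ 2 / 2) * ‖w.1.2 0‖ + √L * ‖w.2‖)
    (isClosed_le (by fun_prop) (by fun_prop)) (fun φ => ?_) hw
  have hc : Continuous φ.1 := (smoothFns.contDiff φ).continuous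
  have m1 : MemLp (fun x : ℝ × ℝ => φ.1 x - φ.1 (L, x.2)) 2 (ductMeasure L) :=
    memLp_duct (by fun_prop)
  have m2 : MemLp (fun x : ℝ × ℝ => φ.1 (L, x.2)) 2 (ductMeasure L) := memLp_duct (by fun_prop)
  have hsplit : (smoothJet L φ).1 = m1.toLp _ + m2.toLp _ := by
    rw [← MemLp.toLp_add m1 m2]
    refine MemLp.toLp_congr (smoothFns.memLp L φ) (m1.add m2) (Eventually.of_forall fun x => ?_)
    simp
  have h1 : ‖m1.toLp _‖ ≤ √(L ^ 2 / 2) * ‖(smoothJet L φ).2 0‖ := by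
    refine le_of_sq_le_sq ?_ (by positivity)
    rw [mul_pow, Real.sq_sqrt (by positivity), norm_sq_toLp, norm_sq_smoothJet_snd]
    exact integral_sub_exit_sq_le hL (smoothFns.contDiff φ)
  have h2 : ‖m2.toLp _‖ ≤ √L * ‖smoothRestrict (exitMap L) (-1) 1 φ‖ := by
    refine le_of_sq_le_sq ?_ (by positivity)
    rw [mul_pow, Real.sq_sqrt hL.le, norm_sq_toLp, norm_sq_smoothRestrict]
    exact (integral_duct_exit_sq hL hc).le
  change ‖(smoothJet L φ).1‖ ≤ _
  rw [hsplit]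
  exact (norm_add_le _ _).trans (add_le_add h1 h2)

/-- The Poincaré inequality for functions vanishing on the exit. -/
theorem poincare {L : ℝ} (hL : 0 < L) {v : Jet L} (hv : v ∈ zeroTrace L (exitMap L) (-1) 1) :
    ‖v.1‖ ^ 2 ≤ L ^ 2 / 2 * ‖v.2 0‖ ^ 2 := by
  have h := norm_le_exit hL (w := (v, 0)) hv
  simp only [norm_zero, mul_zero, add_zero] at h
  calc ‖v.1‖ ^ 2 ≤ (√(L ^ 2 / 2) * ‖v.2 0‖) ^ 2 := by gcongr
    _ = _ := by rw [mul_pow, Real.sq_sqrt (by positivity)]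

theorem norm_entrance_le {L : ℝ} (hL : 0 < L) {w : Jet L × SegmentL2 (-1) 1}
    (hw : w ∈ traceGraph L entranceMap (-1) 1) :
    ‖w.2‖ ≤ √(2 * L + 2 / L) * (‖w.1.1‖ + ‖w.1.2 0‖) := by
  refine traceGraph_induction
    (P := fun w => ‖w.2‖ ≤ √(2 * L + 2 / L) * (‖w.1.1‖ + ‖w.1.2 0‖))
    (isClosed_le (by fun_prop) (by fun_prop)) (fun φ => ?_) hw
  refine le_of_sq_le_sq ?_ (by positivity)
  have h1 : ‖smoothRestrict entranceMap (-1) 1 φ‖ ^ 2 ≤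
      2 * L * ‖(smoothJet L φ).2 0‖ ^ 2 + 2 / L * ‖(smoothJet L φ).1‖ ^ 2 := by
    rw [norm_sq_smoothRestrict, norm_sq_smoothJet_fst, norm_sq_smoothJet_snd]
    exact integral_entrance_sq_le hL (smoothFns.contDiff φ)
  rw [mul_pow, Real.sq_sqrt (by positivity)]
  refine h1.trans ?_
  set p := ‖(smoothJet L φ).2 0‖
  set q := ‖(smoothJet L φ).1‖
  have hp : 0 ≤ p := norm_nonneg _
  have hq : 0 ≤ q := norm_nonneg _
  have h2 : 0 ≤ 2 / L * p ^ 2 := by positivity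
  have h3 : 0 ≤ 2 * L * q ^ 2 := by positivity
  have h4 : 0 ≤ (2 * L + 2 / L) * (2 * (q * p)) := by positivity
  nlinarith

/-- The difference of two candidates is a trace of the zero jet, which the entrance bound forces to
vanish. -/
theorem entrance_unique {L : ℝ} (hL : 0 < L) {v : Jet L} {τ τ' : SegmentL2 (-1) 1}
    (h : (v, τ) ∈ traceGraph L entranceMap (-1) 1)
    (h' : (v, τ') ∈ traceGraph L entranceMap (-1) 1) : τ = τ' := by
  have := norm_entrance_le hL (sub_mem h h')
  simp only [Prod.fst_sub, Prod.snd_sub, sub_self, Prod.fst_zero, Prod.snd_zero, Pi.zero_apply,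
    norm_zero, add_zero, mul_zero] at this
  exact sub_eq_zero.1 (norm_le_zero_iff.1 this)

/-- A limit of smooth functions in `H¹` has a trace on the entrance. -/
theorem exists_entrance {L : ℝ} (hL : 0 < L) {e : C(ℝ, ℝ × ℝ)} {a b : ℝ}
    {w : Jet L × SegmentL2 a b} (hw : w ∈ traceGraph L e a b) :
    ∃ τ, (w.1, τ) ∈ traceGraph L entranceMap (-1) 1 := by
  set T := traceGraph L entranceMap (-1) 1
  have : CompleteSpace T := (isClosed_traceGraph L entranceMap (-1) 1).completeSpace_coe
  let P : T →L[ℝ] Jet L := (ContinuousLinearMap.fst ℝ (Jet L) (SegmentL2 (-1) 1)).comp T.subtypeL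
  set K : ℝ := max 1 (√(2 * L + 2 / L) * 2)
  -- The projection of the entrance graph to jets is bounded below, so its range is closed. The
  -- range contains all smooth jets, hence their limits; the segment `e` serves only to supply a
  -- smooth approximation.
  have hbound : ∀ x : T, ‖x‖ ≤ (K.toNNReal : ℝ) * ‖P x‖ := by
    intro x
    have hPx : P x = x.1.1 := rfl
    have h1 := norm_entrance_le hL x.2
    have h2 : ‖x.1.1.1‖ ≤ ‖x.1.1‖ := norm_fst_le _
    have h3 : ‖x.1.1.2 0‖ ≤ ‖x.1.1‖ := (norm_le_pi_norm _ 0).trans (norm_snd_le _)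
    have h4 : ‖x.1.2‖ ≤ √(2 * L + 2 / L) * 2 * ‖x.1.1‖ := by
      refine h1.trans ?_
      rw [mul_assoc]
      gcongr
      linarith
    rw [Real.coe_toNNReal _ (by positivity), hPx, Submodule.coe_norm, Prod.norm_def]
    refine max_le ?_ (h4.trans ?_)
    · exact le_mul_of_one_le_left (norm_nonneg _) (le_max_left _ _)
    · gcongr; exact le_max_right _ _
  have hcl : IsClosed (Set.range P) :=
    (P.antilipschitz_of_bound hbound).isClosed_range P.uniformContinuous
  have hmem : w.1 ∈ Set.range P := by
    refine traceGraph_induction (P := fun w => w.1 ∈ Set.range P)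
      (hcl.preimage continuous_fst) (fun φ => ?_) hw
    exact ⟨⟨(smoothJet L φ, smoothRestrict entranceMap (-1) 1 φ),
      subset_closure ⟨φ, rfl⟩⟩, rfl⟩
  obtain ⟨x, hx⟩ := hmem
  exact ⟨x.1.2, by rw [← hx]; exact x.2⟩

/-- The exit condition provides the smooth approximation from which an entrance trace exists, so the
default value 0 in `entranceTrace` is not what is being used. -/
theorem entranceTrace_spec {L : ℝ} (hL : 0 < L) {u : H1 L} (hu : VanishesOnExit u) :
    ∃ hτ : MemLp (entranceTrace u) 2 (volume.restrict (Ioo (-1) 1)),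
      (u.jet, hτ.toLp _) ∈ traceGraph L entranceMap (-1) 1 := by
  have h1 : u.jet ∈ zeroTrace L (exitMap L) (-1) 1 := hasTrace_zero_iff.1 hu
  obtain ⟨τ, hτ⟩ := exists_entrance hL (w := (u.jet, 0)) h1
  have hex : ∃ τ, HasTrace u (fun t => (0, t)) (Ioo (-1) 1) τ := by
    refine ⟨τ, (hasTrace_iff (e := entranceMap) (Lp.memLp τ)).2 ?_⟩
    rwa [Lp.toLp_coeFn]
  have hch : HasTrace u entranceMap (Ioo (-1) 1) (entranceTrace u) := by
    rw [entranceTrace, dif_pos hex]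
    exact hex.choose_spec
  exact ⟨hch.1, (hasTrace_iff hch.1).1 hch⟩

/-! ### Pairings and weighted bilinear forms on `L²` -/

section Pairing

variable {X : Type*} [MeasurableSpace X] {μ : Measure X}

/-- Integration against a fixed square integrable function. -/
def pairing {f : X → ℝ} (hf : MemLp f 2 μ) : Lp ℝ 2 μ →L[ℝ] ℝ := innerSL ℝ (hf.toLp f)

theorem pairing_apply {f : X → ℝ} (hf : MemLp f 2 μ) (u : Lp ℝ 2 μ) :
    pairing hf u = ∫ x, f x * u x ∂μ := by
  rw [pairing, innerSL_apply_apply, L2.inner_def]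
  refine integral_congr_ae ?_
  filter_upwards [hf.coeFn_toLp] with x hx
  simp [hx, mul_comm]

theorem integrable_mul_Lp {f : X → ℝ} (hf : MemLp f 2 μ) (u : Lp ℝ 2 μ) :
    Integrable (fun x => f x * u x) μ :=
  hf.integrable_mul (Lp.memLp u)

theorem abs_pairing_le [IsFiniteMeasure μ] {f : X → ℝ} (hf : MemLp f 2 μ) {S : ℝ} (hS : 0 ≤ S)
    (h : ∀ᵐ x ∂μ, |f x| ≤ S) (u : Lp ℝ 2 μ) :
    |pairing hf u| ≤ (measureUnivNNReal μ : ℝ) ^ (2 : ℝ)⁻¹ * S * ‖u‖ := by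
  have h1 : ‖hf.toLp f‖ ≤ (measureUnivNNReal μ : ℝ) ^ (2 : ℝ)⁻¹ * S := by
    have := Lp.norm_le_of_ae_bound (p := 2) (f := hf.toLp f) hS (by
      filter_upwards [hf.coeFn_toLp, h] with x hx h'
      rwa [hx])
    simpa using this
  calc |pairing hf u| ≤ ‖hf.toLp f‖ * ‖u‖ := abs_real_inner_le_norm (hf.toLp f) u
    _ ≤ _ := by gcongr

/-- The inner product of `L²` as a bounded bilinear form. -/
def l2Form : Lp ℝ 2 μ →L[ℝ] Lp ℝ 2 μ →L[ℝ] ℝ := innerSL ℝ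

theorem l2Form_apply (u v : Lp ℝ 2 μ) : l2Form u v = ∫ x, u x * v x ∂μ := by
  change inner ℝ u v = _
  rw [L2.inner_def]
  simp [mul_comm]

theorem memLp_mul_top {a : X → ℝ} (ha : MemLp a ⊤ μ) (u : Lp ℝ 2 μ) :
    MemLp (fun x => a x * u x) 2 μ :=
  (Lp.memLp u).mul' ha

theorem integrable_weighted {a : X → ℝ} (ha : MemLp a ⊤ μ) (u v : Lp ℝ 2 μ) :
    Integrable (fun x => a x * u x * v x) μ :=
  integrable_mul_Lp (memLp_mul_top ha u) v

/-- The bilinear form `∫ a u v` on `L²` for a bounded weight `a`. -/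
def weightedForm {a : X → ℝ} (ha : MemLp a ⊤ μ) : Lp ℝ 2 μ →L[ℝ] Lp ℝ 2 μ →L[ℝ] ℝ :=
  (innerSL ℝ).comp ((ContinuousLinearMap.mul ℝ ℝ).holderL μ ⊤ 2 2 (ha.toLp a))

theorem weightedForm_apply {a : X → ℝ} (ha : MemLp a ⊤ μ) (u v : Lp ℝ 2 μ) :
    weightedForm ha u v = ∫ x, a x * u x * v x ∂μ := by
  rw [weightedForm, ContinuousLinearMap.comp_apply, innerSL_apply_apply, L2.inner_def]
  refine integral_congr_ae ?_
  filter_upwards [ha.coeFn_toLp,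
    (ContinuousLinearMap.mul ℝ ℝ).coeFn_holder (r := 2) (ha.toLp a) u] with x h1 h2
  rw [ContinuousLinearMap.holderL_apply_apply, h2, ContinuousLinearMap.mul_apply', h1]
  simp [mul_comm]

end Pairing

/-! ### The Hilbert space of admissible pairs -/

/-- Pairs of an `L²` function and its weak gradient. -/
def weakGraph (L : ℝ) : Submodule ℝ (Jet L) :=
  ⨅ (i : Fin 2) (φ : smoothFns) (_ : HasCompactSupport φ.1) (_ : tsupport φ.1 ⊆ duct L),
    LinearMap.ker (((pairing (smoothFns.memLp_partialD L φ i)).comp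
      (ContinuousLinearMap.fst ℝ _ _) + ((pairing (smoothFns.memLp L φ)).comp
        ((ContinuousLinearMap.proj i).comp (ContinuousLinearMap.snd ℝ _ _))) : Jet L →L[ℝ] ℝ) :
          Jet L →ₗ[ℝ] ℝ)

theorem isClosed_weakGraph (L : ℝ) : IsClosed (weakGraph L : Set (Jet L)) := by
  simp only [weakGraph, Submodule.coe_iInf]
  exact isClosed_iInter fun i => isClosed_iInter fun φ => isClosed_iInter fun _ =>
    isClosed_iInter fun _ => ContinuousLinearMap.isClosed_ker _

theorem mem_weakGraph_iff {L : ℝ} {w : Jet L} : w ∈ weakGraph L ↔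
    ∀ (i : Fin 2) (φ : ℝ × ℝ → ℝ), ContDiff ℝ ∞ φ → HasCompactSupport φ →
      tsupport φ ⊆ duct L →
      ∫ x in duct L, w.1 x * partialD i φ x = -∫ x in duct L, w.2 i x * φ x := by
  simp only [weakGraph, Submodule.mem_iInf]
  have key : ∀ (i : Fin 2) (φ : smoothFns),
      w ∈ LinearMap.ker (((pairing (smoothFns.memLp_partialD L φ i)).comp
      (ContinuousLinearMap.fst ℝ _ _) + ((pairing (smoothFns.memLp L φ)).comp
        ((ContinuousLinearMap.proj i).comp (ContinuousLinearMap.snd ℝ _ _))) : Jet L →L[ℝ] ℝ) :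
          Jet L →ₗ[ℝ] ℝ) ↔
      ∫ x in duct L, w.1 x * partialD i φ.1 x = -∫ x in duct L, w.2 i x * φ.1 x := by
    intro i φ
    rw [LinearMap.mem_ker]
    change pairing (smoothFns.memLp_partialD L φ i) w.1 + pairing (smoothFns.memLp L φ) (w.2 i) = 0
      ↔ _
    rw [pairing_apply, pairing_apply, add_eq_zero_iff_eq_neg]
    simp only [mul_comm]
  exact ⟨fun h i φ hφ hc hs => (key i ⟨φ, hφ⟩).1 (h i ⟨φ, hφ⟩ hc hs),
    fun h i φ hc hs => (key i φ).2 (h i φ.1 (smoothFns.contDiff φ) hc hs)⟩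

theorem H1.jet_mem {L : ℝ} (u : H1 L) : u.jet ∈ weakGraph L := mem_weakGraph_iff.2 u.weak

/-- The element of `H¹` with given function and weak gradient. -/
def H1.ofJet {L : ℝ} (w : Jet L) (hw : w ∈ weakGraph L) : H1 L := ⟨w.1, w.2, mem_weakGraph_iff.1 hw⟩

/-- The jets of `H¹` functions vanishing on the exit. -/
def exitJets (L : ℝ) : Submodule ℝ (Jet L) := weakGraph L ⊓ zeroTrace L (exitMap L) (-1) 1

/-- The jets of `H¹` functions vanishing on the exit and the walls. -/
def exitWallJets (L : ℝ) : Submodule ℝ (Jet L) :=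
  exitJets L ⊓ (zeroTrace L (wallMap (-1)) 0 L ⊓ zeroTrace L (wallMap 1) 0 L)

theorem isClosed_exitJets (L : ℝ) : IsClosed (exitJets L : Set (Jet L)) :=
  (isClosed_weakGraph L).inter (isClosed_zeroTrace _ _ _ _)

theorem isClosed_exitWallJets (L : ℝ) : IsClosed (exitWallJets L : Set (Jet L)) :=
  (isClosed_exitJets L).inter ((isClosed_zeroTrace _ _ _ _).inter (isClosed_zeroTrace _ _ _ _))

theorem mem_spaceH_iff {L : ℝ} {p : H1 L × H1 L} :
    p ∈ spaceH L ↔ p.1.jet ∈ exitWallJets L ∧ p.2.jet ∈ exitJets L := by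
  have hw : VanishesOnWalls p.1 ↔ p.1.jet ∈ zeroTrace L (wallMap (-1)) 0 L ∧
      p.1.jet ∈ zeroTrace L (wallMap 1) 0 L :=
    and_congr (hasTrace_zero_iff (e := wallMap (-1))) (hasTrace_zero_iff (e := wallMap 1))
  have he : ∀ u : H1 L, VanishesOnExit u ↔ u.jet ∈ zeroTrace L (exitMap L) (-1) 1 :=
    fun u => hasTrace_zero_iff (e := exitMap L)
  have h1 := p.1.jet_mem
  have h2 := p.2.jet_mem
  simp only [spaceH, mem_ofPred_eq, hw, he, exitWallJets, exitJets, Submodule.mem_inf]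
  tauto

/-- The ambient Hilbert space: two functions, each with two derivatives. -/
abbrev Ambient (L : ℝ) := PiLp 2 (fun _ : Fin 2 × Option (Fin 2) => DuctL2 L)

/-- The jet of the `k`-th function. -/
def ambientJet (L : ℝ) (k : Fin 2) : Ambient L →L[ℝ] Jet L :=
  (PiLp.proj 2 (fun _ : Fin 2 × Option (Fin 2) => DuctL2 L) (k, none)).prod
    (ContinuousLinearMap.pi fun i =>
      PiLp.proj 2 (fun _ : Fin 2 × Option (Fin 2) => DuctL2 L) (k, some i))

/-- The space of admissible pairs as a closed subspace of the ambient Hilbert space. -/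
def energySpace (L : ℝ) : Submodule ℝ (Ambient L) :=
  (exitWallJets L).comap (ambientJet L 0 : Ambient L →ₗ[ℝ] Jet L) ⊓
    (exitJets L).comap (ambientJet L 1 : Ambient L →ₗ[ℝ] Jet L)

theorem isClosed_energySpace (L : ℝ) : IsClosed (energySpace L : Set (Ambient L)) :=
  ((isClosed_exitWallJets L).preimage (ambientJet L 0).continuous).inter
    ((isClosed_exitJets L).preimage (ambientJet L 1).continuous)

instance completeSpace_energySpace (L : ℝ) : CompleteSpace (energySpace L) :=
  (isClosed_energySpace L).completeSpace_coe

/-- The pair of `H¹` functions given by an element of the energy space. -/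
def toPair {L : ℝ} (v : energySpace L) : H1 L × H1 L :=
  (H1.ofJet (ambientJet L 0 v) v.2.1.1.1, H1.ofJet (ambientJet L 1 v) v.2.2.1)

theorem toPair_mem {L : ℝ} (v : energySpace L) : toPair v ∈ spaceH L :=
  mem_spaceH_iff.2 ⟨v.2.1, v.2.2⟩

theorem exists_toPair_eq {L : ℝ} {p : H1 L × H1 L} (hp : p ∈ spaceH L) :
    ∃ v : energySpace L, toPair v = p := by
  rw [mem_spaceH_iff] at hp
  let w : Ambient L := WithLp.toLp 2 fun j =>
    (j.2.elim (![p.1, p.2] j.1).val (![p.1, p.2] j.1).grad)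
  have h0 : ambientJet L 0 w = p.1.jet := rfl
  have h1 : ambientJet L 1 w = p.2.jet := rfl
  refine ⟨⟨w, ?_, ?_⟩, rfl⟩
  · exact hp.1
  · exact hp.2

theorem H1.norm_sq {L : ℝ} (u : H1 L) : u.norm ^ 2 = ‖u.val‖ ^ 2 + ∑ i, ‖u.grad i‖ ^ 2 :=
  Real.sq_sqrt (by positivity)

theorem H1.norm_nonneg {L : ℝ} (u : H1 L) : 0 ≤ u.norm := Real.sqrt_nonneg _

theorem H1.norm_val_le {L : ℝ} (u : H1 L) : ‖u.val‖ ≤ u.norm :=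
  Real.le_sqrt_of_sq_le (le_add_of_nonneg_right (by positivity))

theorem H1.norm_grad_le {L : ℝ} (u : H1 L) (i : Fin 2) : ‖u.grad i‖ ≤ u.norm := by
  refine Real.le_sqrt_of_sq_le ?_
  have := Finset.single_le_sum (f := fun i => ‖u.grad i‖ ^ 2) (fun j _ => sq_nonneg _)
    (Finset.mem_univ i)
  exact this.trans (le_add_of_nonneg_left (by positivity))

theorem pairNorm_nonneg {L : ℝ} (p : H1 L × H1 L) : 0 ≤ pairNorm p :=
  add_nonneg p.1.norm_nonneg p.2.norm_nonneg

theorem norm_sq_eq_toPair {L : ℝ} (v : energySpace L) :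
    ‖v‖ ^ 2 = (toPair v).1.norm ^ 2 + (toPair v).2.norm ^ 2 := by
  rw [H1.norm_sq, H1.norm_sq, Submodule.coe_norm, PiLp.norm_sq_eq_of_L2, Fintype.sum_prod_type,
    Fin.sum_univ_two, Fintype.sum_option, Fintype.sum_option]
  rfl

/-- Transfers coercivity from the sum norm of the statement to the Hilbert norm needed for
Lax–Milgram. -/
theorem norm_le_pairNorm {L : ℝ} (v : energySpace L) : ‖v‖ ≤ pairNorm (toPair v) := by
  refine le_of_sq_le_sq ?_ (pairNorm_nonneg _)
  rw [norm_sq_eq_toPair, pairNorm]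
  nlinarith [(toPair v).1.norm_nonneg, (toPair v).2.norm_nonneg,
    mul_nonneg (toPair v).1.norm_nonneg (toPair v).2.norm_nonneg]

/-- A component of an element of the energy space. -/
def component (L : ℝ) (j : Fin 2 × Option (Fin 2)) : energySpace L →L[ℝ] DuctL2 L :=
  (PiLp.proj 2 (fun _ : Fin 2 × Option (Fin 2) => DuctL2 L) j).comp (energySpace L).subtypeL

theorem toPair_fst_val {L : ℝ} (v : energySpace L) :
    (toPair v).1.val = component L (0, none) v := rfl
theorem toPair_snd_val {L : ℝ} (v : energySpace L) :
    (toPair v).2.val = component L (1, none) v := rfl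
theorem toPair_fst_grad {L : ℝ} (v : energySpace L) (i : Fin 2) :
    (toPair v).1.grad i = component L (0, some i) v := rfl
theorem toPair_snd_grad {L : ℝ} (v : energySpace L) (i : Fin 2) :
    (toPair v).2.grad i = component L (1, some i) v := rfl

/-! ### The bilinear form -/

/-- The coefficients of the linear problem are bounded and measurable. -/
structure BoundedCoefs (D : BackgroundData) (G : ℝ → ℝ) : Prop where
  a : ∀ i, MemLp (D.coefA G i i) ⊤ (ductMeasure D.L)
  b : ∀ i, MemLp (D.coefB G i) ⊤ (ductMeasure D.L)
  c : ∀ i, MemLp (D.coefC G i) ⊤ (ductMeasure D.L)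
  d : MemLp (D.coefD G) ⊤ (ductMeasure D.L)

variable {D : BackgroundData} {G : ℝ → ℝ}

theorem bilinForm_eq (h : BoundedCoefs D G) (p r : H1 D.L × H1 D.L) :
    bilinForm D G p r =
      (∑ i, (weightedForm (h.a i) (p.1.grad i) (r.1.grad i) +
        weightedForm (h.b i) p.2.val (r.1.grad i))) +
      (∑ i, l2Form (p.2.grad i) (r.2.grad i)) +
      (weightedForm h.d p.2.val r.2.val +
        ∑ i, weightedForm (h.c i) (p.1.grad i) r.2.val) := by
  have ha := fun i => integrable_weighted (h.a i) (p.1.grad i) (r.1.grad i)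
  have hb := fun i => integrable_weighted (h.b i) p.2.val (r.1.grad i)
  have hc := fun i => integrable_weighted (h.c i) (p.1.grad i) r.2.val
  have hd := integrable_weighted h.d p.2.val r.2.val
  have hg := fun i => integrable_mul_Lp (Lp.memLp (p.2.grad i)) (r.2.grad i)
  have hab : ∀ i, Integrable (fun x => D.coefA G i i x * p.1.grad i x * r.1.grad i x +
      D.coefB G i x * p.2.val x * r.1.grad i x) (ductMeasure D.L) := fun i => (ha i).add (hb i)
  simp only [weightedForm_apply, l2Form_apply]
  have sab := integrable_finsetSum Finset.univ fun i _ => hab i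
  have sg := integrable_finsetSum Finset.univ fun i _ => hg i
  have sc := integrable_finsetSum Finset.univ fun i _ => hc i
  rw [← integral_finsetSum _ fun i _ => hg i, ← integral_finsetSum _ fun i _ => hc i,
    ← integral_add hd sc, Finset.sum_congr rfl fun i _ => (integral_add (ha i) (hb i)).symm,
    ← integral_finsetSum _ fun i _ => hab i, ← integral_add sab sg]
  refine Eq.trans ?_ (integral_add (sab.add sg) (hd.add sc))
  refine integral_congr_ae (Eventually.of_forall fun x => ?_)
  simp only [Fin.sum_univ_two]
  ring

/-- The bilinear form as a bounded form on the energy space. -/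
theorem exists_bilinForm_eq (h : BoundedCoefs D G) :
    ∃ B : energySpace D.L →L[ℝ] energySpace D.L →L[ℝ] ℝ,
      ∀ v r, B v r = bilinForm D G (toPair v) (toPair r) := by
  let P := component D.L
  refine ⟨(∑ i, ((weightedForm (h.a i)).bilinearComp (P (0, some i)) (P (0, some i)) +
        (weightedForm (h.b i)).bilinearComp (P (1, none)) (P (0, some i)))) +
      (∑ i, l2Form.bilinearComp (P (1, some i)) (P (1, some i))) +
      ((weightedForm h.d).bilinearComp (P (1, none)) (P (1, none)) +
        ∑ i, (weightedForm (h.c i)).bilinearComp (P (0, some i)) (P (1, none))), fun v r => ?_⟩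
  rw [bilinForm_eq h]
  simp only [Fin.sum_univ_two, toPair_fst_grad, toPair_snd_grad, toPair_snd_val]
  rfl

/-! ### The right-hand side -/

theorem abs_le_supNorm {X : Type*} [TopologicalSpace X] {s : Set X} (hs : IsCompact s) {f : X → ℝ}
    (hf : ContinuousOn f s) {x : X} (hx : x ∈ s) : |f x| ≤ supNorm s f :=
  le_csSup (hs.bddAbove_image hf.abs) ⟨x, hx, rfl⟩

theorem supNorm_nonneg {X : Type*} (s : Set X) (f : X → ℝ) : 0 ≤ supNorm s f := by
  refine Real.sSup_nonneg ?_
  rintro _ ⟨x, _, rfl⟩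
  exact abs_nonneg _

theorem isCompact_closure_duct {L : ℝ} (hL : 0 < L) : IsCompact (closure (duct L)) := by
  rw [closure_duct hL]; exact isCompact_box L

namespace LinearData.IsC0

variable {L : ℝ} {d : LinearData}

theorem memLp_of_continuousOn (hL : 0 < L) {f : ℝ × ℝ → ℝ} (hf : ContinuousOn f (closure (duct L))) :
    MemLp f 2 (ductMeasure L) :=
  memLp_of_continuousOn_compact (measurableSet_duct L) (isCompact_closure_duct hL) subset_closure hf

theorem ae_abs_le (hL : 0 < L) {f : ℝ × ℝ → ℝ} (hf : ContinuousOn f (closure (duct L))) :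
    ∀ᵐ x ∂(ductMeasure L), |f x| ≤ supNorm (closure (duct L)) f := by
  filter_upwards [ae_restrict_mem (measurableSet_duct L)] with x hx
  exact abs_le_supNorm (isCompact_closure_duct hL) hf (subset_closure hx)

theorem entrance_mem (hL : 0 < L) {t : ℝ} (ht : t ∈ Icc (-1 : ℝ) 1) :
    ((0 : ℝ), t) ∈ closure (duct L) := by
  rw [closure_duct hL]
  exact ⟨left_mem_Icc.2 hL.le, ht⟩

theorem continuousOn_entrance (h : d.IsC0 L) (hL : 0 < L) :
    ContinuousOn (fun t => d.F 0 (0, t)) (Icc (-1) 1) :=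
  (h.F 0).comp (by fun_prop) fun _ ht => entrance_mem hL ht

theorem memLp_entrance (h : d.IsC0 L) (hL : 0 < L) :
    MemLp (fun t => d.F 0 (0, t)) 2 (volume.restrict (Ioo (-1) 1)) :=
  memLp_of_continuousOn_compact measurableSet_Ioo isCompact_Icc Ioo_subset_Icc_self
    (h.continuousOn_entrance hL)

theorem memLp_gen (h : d.IsC0 L) : MemLp d.gen 2 (volume.restrict (Ioo (-1) 1)) :=
  memLp_of_continuousOn_compact measurableSet_Ioo isCompact_Icc Ioo_subset_Icc_self h.gen

/-- Replacing the chosen trace by any a.e. equal L² class frees the functional from the choice in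
`entranceTrace` and shows it to be a sum of continuous pairings. -/
theorem functional_eq (h : d.IsC0 L) (hL : 0 < L) (r : H1 L × H1 L) {τ σ : SegmentL2 (-1) 1}
    (hτ : entranceTrace r.1 =ᵐ[volume.restrict (Ioo (-1) 1)] τ)
    (hσ : entranceTrace r.2 =ᵐ[volume.restrict (Ioo (-1) 1)] σ) :
    d.functional r =
      ((∑ i, pairing (memLp_of_continuousOn hL (h.F i)) (r.1.grad i)) +
        ∑ i, pairing (memLp_of_continuousOn hL (h.G i)) (r.2.grad i)) -
      (pairing (memLp_of_continuousOn hL h.f) r.1.val +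
        pairing (memLp_of_continuousOn hL h.g) r.2.val) +
      (pairing (h.memLp_entrance hL) τ - pairing h.memLp_gen σ) := by
  have iF := fun i => integrable_mul_Lp (memLp_of_continuousOn hL (h.F i)) (r.1.grad i)
  have iG := fun i => integrable_mul_Lp (memLp_of_continuousOn hL (h.G i)) (r.2.grad i)
  have i1 := integrable_mul_Lp (memLp_of_continuousOn hL h.f) r.1.val
  have i2 := integrable_mul_Lp (memLp_of_continuousOn hL h.g) r.2.val
  have i3 := integrable_mul_Lp (h.memLp_entrance hL) τ
  have i4 := integrable_mul_Lp h.memLp_gen σ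
  simp only [pairing_apply]
  rw [← integral_add i1 i2, ← integral_sub i3 i4, ← integral_finsetSum _ fun i _ => iF i,
    ← integral_finsetSum _ fun i _ => iG i,
    ← integral_add (integrable_finsetSum _ fun i _ => iF i)
      (integrable_finsetSum _ fun i _ => iG i)]
  have e : ∫ t in Ioo (-1 : ℝ) 1,
      (d.F 0 (0, t) * entranceTrace r.1 t - d.gen t * entranceTrace r.2 t) =
      ∫ t in Ioo (-1 : ℝ) 1, (d.F 0 (0, t) * τ t - d.gen t * σ t) := by
    refine integral_congr_ae ?_
    filter_upwards [hτ, hσ] with t h1 h2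
    rw [h1, h2]
  rw [LinearData.functional, e]

end LinearData.IsC0

/-- The entrance trace of jets vanishing on the exit. -/
theorem exists_entranceOp {L : ℝ} (hL : 0 < L) :
    ∃ T : exitJets L →L[ℝ] SegmentL2 (-1) 1,
      ∀ v : exitJets L, ((v : Jet L), T v) ∈ traceGraph L entranceMap (-1) 1 := by
  have hex : ∀ v : exitJets L, ∃ τ, ((v : Jet L), τ) ∈ traceGraph L entranceMap (-1) 1 :=
    fun v => exists_entrance hL (w := ((v : Jet L), 0)) v.2.2
  -- Uniqueness of entrance traces makes the chosen map linear.
  choose T hT using hex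
  let T' : exitJets L →ₗ[ℝ] SegmentL2 (-1) 1 :=
    { toFun := T
      map_add' := fun v w => entrance_unique hL (hT (v + w)) (add_mem (hT v) (hT w))
      map_smul' := fun c v => entrance_unique hL (hT (c • v)) (Submodule.smul_mem _ c (hT v)) }
  refine ⟨T'.mkContinuous (√(2 * L + 2 / L) * 2) fun v => ?_, hT⟩
  refine (norm_entrance_le hL (hT v)).trans ?_
  have h2 : ‖(v : Jet L).1‖ ≤ ‖v‖ := norm_fst_le (v : Jet L)
  have h3 : ‖(v : Jet L).2 0‖ ≤ ‖v‖ := (norm_le_pi_norm _ 0).trans (norm_snd_le (v : Jet L))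
  rw [mul_assoc]
  refine mul_le_mul_of_nonneg_left ?_ (Real.sqrt_nonneg _)
  linarith

theorem entranceTrace_ae_eq {L : ℝ} (hL : 0 < L) {u : H1 L} (hu : u.jet ∈ exitJets L)
    {τ : SegmentL2 (-1) 1} (hτ : (u.jet, τ) ∈ traceGraph L entranceMap (-1) 1) :
    entranceTrace u =ᵐ[volume.restrict (Ioo (-1) 1)] τ := by
  have hv : VanishesOnExit u := (hasTrace_zero_iff (e := exitMap L)).2 hu.2
  obtain ⟨hm, h⟩ := entranceTrace_spec hL hv
  rw [entrance_unique hL hτ h]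
  exact hm.coeFn_toLp.symm

/-- The right-hand side is a bounded functional on the energy space. -/
theorem exists_functional_eq {L : ℝ} (hL : 0 < L) {d : LinearData} (h : d.IsC0 L) :
    ∃ ℓ : energySpace L →L[ℝ] ℝ, ∀ v, ℓ v = d.functional (toPair v) := by
  obtain ⟨T, hT⟩ := exists_entranceOp hL
  let J (k : Fin 2) : energySpace L →L[ℝ] Jet L := (ambientJet L k).comp (energySpace L).subtypeL
  have h0 : ∀ v : energySpace L, J 0 v ∈ exitJets L := fun v => v.2.1.1
  have h1 : ∀ v : energySpace L, J 1 v ∈ exitJets L := fun v => v.2.2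
  let P := component L
  refine ⟨((∑ i, (pairing (LinearData.IsC0.memLp_of_continuousOn hL (h.F i))).comp (P (0, some i))) +
        ∑ i, (pairing (LinearData.IsC0.memLp_of_continuousOn hL (h.G i))).comp (P (1, some i))) -
      ((pairing (LinearData.IsC0.memLp_of_continuousOn hL h.f)).comp (P (0, none)) +
        (pairing (LinearData.IsC0.memLp_of_continuousOn hL h.g)).comp (P (1, none))) +
      (((pairing (h.memLp_entrance hL)).comp T).comp ((J 0).codRestrict _ h0) -
        ((pairing h.memLp_gen).comp T).comp ((J 1).codRestrict _ h1)), fun v => ?_⟩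
  have e0 := entranceTrace_ae_eq hL (u := (toPair v).1) (h0 v) (hT ⟨_, h0 v⟩)
  have e1 := entranceTrace_ae_eq hL (u := (toPair v).2) (h1 v) (hT ⟨_, h1 v⟩)
  rw [h.functional_eq hL _ e0 e1]
  simp only [Fin.sum_univ_two, toPair_fst_grad, toPair_snd_grad, toPair_snd_val, toPair_fst_val]
  rfl

/-- The right-hand side is controlled by the `C⁰` norm of the data. -/
theorem exists_functional_le {L : ℝ} (hL : 0 < L) :
    ∃ K > 0, ∀ d : LinearData, d.IsC0 L → ∀ r ∈ spaceH L,
      |d.functional r| ≤ K * d.norm L * pairNorm r := by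
  set κ : ℝ := (measureUnivNNReal (ductMeasure L) : ℝ) ^ (2 : ℝ)⁻¹ with hκ
  set κ' : ℝ := (measureUnivNNReal (volume.restrict (Ioo (-1 : ℝ) 1)) : ℝ) ^ (2 : ℝ)⁻¹ with hκ'
  have hκ0 : 0 ≤ κ := by positivity
  have hκ'0 : 0 ≤ κ' := by positivity
  set E : ℝ := √(2 * L + 2 / L) * 2 with hE
  have hE0 : 0 ≤ E := by positivity
  -- κ and κ' are the square roots of the measures of the duct and the entrance, E is the trace
  -- constant, and 1 ensures positivity.
  refine ⟨κ + κ' * E + 1, by positivity, fun d h r hr => ?_⟩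
  obtain ⟨T, hT⟩ := exists_entranceOp hL
  rw [mem_spaceH_iff] at hr
  have hτ := hT ⟨r.1.jet, hr.1.1⟩
  have hσ := hT ⟨r.2.jet, hr.2⟩
  set τ := T ⟨r.1.jet, hr.1.1⟩
  set σ := T ⟨r.2.jet, hr.2⟩
  rw [h.functional_eq hL r (entranceTrace_ae_eq hL hr.1.1 hτ) (entranceTrace_ae_eq hL hr.2 hσ)]
  set N := pairNorm r with hN
  have hN0 : 0 ≤ N := pairNorm_nonneg r
  have hN1 : r.1.norm ≤ N := le_add_of_nonneg_right r.2.norm_nonneg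
  have hN2 : r.2.norm ≤ N := le_add_of_nonneg_left r.1.norm_nonneg
  have htr : ∀ (u : H1 L) (τ : SegmentL2 (-1) 1), (u.jet, τ) ∈ traceGraph L entranceMap (-1) 1 →
      ‖τ‖ ≤ E * u.norm := fun u τ hu => by
    refine (norm_entrance_le hL hu).trans ?_
    rw [hE, mul_assoc]
    refine mul_le_mul_of_nonneg_left ?_ (Real.sqrt_nonneg _)
    linarith [u.norm_val_le, u.norm_grad_le 0, show ‖u.jet.1‖ = ‖u.val‖ from rfl,
      show ‖u.jet.2 0‖ = ‖u.grad 0‖ from rfl]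
  have bd : ∀ {f : ℝ × ℝ → ℝ} (hf : ContinuousOn f (closure (duct L))) (u : DuctL2 L), ‖u‖ ≤ N →
      |pairing (LinearData.IsC0.memLp_of_continuousOn hL hf) u| ≤
        supNorm (closure (duct L)) f * (κ * N) := fun {f} hf u hu => by
    refine (abs_pairing_le _ (supNorm_nonneg _ f) (LinearData.IsC0.ae_abs_le hL hf) u).trans ?_
    have h0 := supNorm_nonneg (closure (duct L)) f
    calc κ * supNorm (closure (duct L)) f * ‖u‖ ≤ κ * supNorm (closure (duct L)) f * N := by gcongr
      _ = _ := by ring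
  have bF := fun i => bd (h.F i) (r.1.grad i) ((r.1.norm_grad_le i).trans hN1)
  have bG := fun i => bd (h.G i) (r.2.grad i) ((r.2.norm_grad_le i).trans hN2)
  have bf := bd h.f r.1.val (r.1.norm_val_le.trans hN1)
  have bg := bd h.g r.2.val (r.2.norm_val_le.trans hN2)
  have bτ : |pairing (h.memLp_entrance hL) τ| ≤
      supNorm (closure (duct L)) (d.F 0) * (κ' * E * N) := by
    have h0 := supNorm_nonneg (closure (duct L)) (d.F 0)
    refine (abs_pairing_le _ h0 ?_ τ).trans ?_
    · filter_upwards [ae_restrict_mem measurableSet_Ioo] with t ht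
      exact abs_le_supNorm (isCompact_closure_duct hL) (h.F 0)
        (LinearData.IsC0.entrance_mem hL (Ioo_subset_Icc_self ht))
    · have : ‖τ‖ ≤ E * N := (htr _ _ hτ).trans (by gcongr)
      calc κ' * supNorm (closure (duct L)) (d.F 0) * ‖τ‖
          ≤ κ' * supNorm (closure (duct L)) (d.F 0) * (E * N) := by gcongr
        _ = _ := by ring
  have bσ : |pairing h.memLp_gen σ| ≤ supNorm (Icc (-1) 1) d.gen * (κ' * E * N) := by
    have h0 := supNorm_nonneg (Icc (-1) 1) d.gen
    refine (abs_pairing_le _ h0 ?_ σ).trans ?_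
    · filter_upwards [ae_restrict_mem measurableSet_Ioo] with t ht
      exact abs_le_supNorm isCompact_Icc h.gen (Ioo_subset_Icc_self ht)
    · have : ‖σ‖ ≤ E * N := (htr _ _ hσ).trans (by gcongr)
      calc κ' * supNorm (Icc (-1) 1) d.gen * ‖σ‖
          ≤ κ' * supNorm (Icc (-1) 1) d.gen * (E * N) := by gcongr
        _ = _ := by ring
  have s1 := supNorm_nonneg (closure (duct L)) d.f
  have s2 := supNorm_nonneg (closure (duct L)) d.g
  have s3 := fun i => supNorm_nonneg (closure (duct L)) (d.F i)
  have s4 := fun i => supNorm_nonneg (closure (duct L)) (d.G i)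
  have s5 := supNorm_nonneg (Icc (-1) 1) d.gen
  have t1 : 0 ≤ κ * N := by positivity
  have t2 : 0 ≤ κ' * E * N := by positivity
  have hnorm : (κ + κ' * E + 1) * d.norm L * N = d.norm L * (κ * N) + d.norm L * (κ' * E * N)
      + d.norm L * N := by ring
  rw [hnorm, LinearData.norm]
  simp only [Fin.sum_univ_two]
  have bF0 := abs_le.1 (bF 0)
  have bF1 := abs_le.1 (bF 1)
  have bG0 := abs_le.1 (bG 0)
  have bG1 := abs_le.1 (bG 1)
  rw [abs_le] at bf bg bτ bσ
  -- Most data enter through the interior or the entrance alone (only 𝔉*₁ enters through both);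
  -- these nonnegative products fill up the bound to the full norm.
  have p0 := mul_nonneg s1 t2
  have p1 := mul_nonneg s2 t2
  have p2 := mul_nonneg (s3 1) t2
  have p3 := mul_nonneg (s4 0) t2
  have p4 := mul_nonneg (s4 1) t2
  have p5 := mul_nonneg s5 t1
  have p6 := mul_nonneg s1 hN0
  have p7 := mul_nonneg s2 hN0
  have p8 := mul_nonneg (s3 0) hN0
  have p9 := mul_nonneg (s3 1) hN0
  have p10 := mul_nonneg (s4 0) hN0
  have p11 := mul_nonneg (s4 1) hN0
  have p12 := mul_nonneg s5 hN0
  simp only [add_mul]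
  rw [abs_le]
  constructor <;> linarith [bF0.1, bF0.2, bF1.1, bF1.2, bG0.1, bG0.2, bG1.1, bG1.2, bf.1, bf.2,
    bg.1, bg.2, bτ.1, bτ.2, bσ.1, bσ.2]

/-! ### Coercivity -/

theorem mul_norm_sq_le_weightedForm {X : Type*} [MeasurableSpace X] {μ : Measure X} {a : X → ℝ}
    (ha : MemLp a ⊤ μ) {m : ℝ} (h : ∀ᵐ x ∂μ, m ≤ a x) (u : Lp ℝ 2 μ) :
    m * ‖u‖ ^ 2 ≤ weightedForm ha u u := by
  have hu : ‖u‖ ^ 2 = ∫ x, u x * u x ∂μ := by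
    rw [← l2Form_apply]
    exact (real_inner_self_eq_norm_sq u).symm
  rw [hu, weightedForm_apply, ← integral_const_mul]
  refine integral_mono_ae ((integrable_mul_Lp (Lp.memLp u) u).const_mul m)
    (integrable_weighted ha u u) ?_
  filter_upwards [h] with x hx
  rw [mul_assoc]
  exact mul_le_mul_of_nonneg_right hx (mul_self_nonneg _)

theorem memLp_top_duct {L : ℝ} {k : ℝ → ℝ} (hk : ContinuousOn k (Icc 0 L)) {f : ℝ × ℝ → ℝ}
    (hf : ∀ x ∈ duct L, f x = k x.1) : MemLp f ⊤ (ductMeasure L) := by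
  obtain ⟨C, hC⟩ := isCompact_Icc.exists_bound_of_continuousOn hk
  have hmem : ∀ x ∈ duct L, x.1 ∈ Icc 0 L := fun x hx => Ioo_subset_Icc_self hx.1
  have hkc : ContinuousOn (fun x : ℝ × ℝ => k x.1) (duct L) :=
    hk.comp continuous_fst.continuousOn hmem
  refine memLp_top_of_bound ((hkc.congr hf).aestronglyMeasurable (measurableSet_duct L)) C ?_
  filter_upwards [ae_restrict_mem (measurableSet_duct L)] with x hx
  rw [hf x hx]
  exact hC _ (hmem x hx)

variable {D : BackgroundData} {ρ G : ℝ → ℝ}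

/-- These bounds may depend on the flow. They serve only to make the form continuous and do not
enter the final constants. -/
theorem BackgroundData.IsBackground.boundedCoefs (h : D.IsBackground ρ G) (hγ : 1 < D.γ)
    (hρ₀ : D.criticalDensity < D.ρ₀) : BoundedCoefs D G := by
  have hρ := h.continuousOn_density
  have hg := h.continuousOn_sonicGap
  have hρ0 : ∀ t ∈ Icc 0 D.L, ρ t ≠ 0 := fun t ht => (h.density_pos t ht).ne'
  have hg0 : ∀ t ∈ Icc 0 D.L, D.sonicGap (ρ t) ≠ 0 := fun t ht => (h.sonicGap_pos hγ hρ₀ ht).ne'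
  have hmem : ∀ x ∈ duct D.L, x.1 ∈ Icc 0 D.L := fun x hx => Ioo_subset_Icc_self hx.1
  have hq : ∀ (i : Fin 2) (x : ℝ × ℝ), D.gradPsi₀ x i = ![0, D.m₀] i := fun i x => by
    rw [D.gradPsi₀_eq]
  refine ⟨fun i => ?_, fun i => ?_, fun i => ?_, ?_⟩
  · refine memLp_top_duct (k := fun t => 1 / ρ t +
      ![0, D.m₀] i ^ 2 / (ρ t ^ 3 * D.sonicGap (ρ t))) ?_ fun x hx => ?_
    · exact (continuousOn_const.div hρ hρ0).add (continuousOn_const.div ((hρ.pow 3).mul hg)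
        fun t ht => mul_ne_zero (pow_ne_zero 3 (hρ0 t ht)) (hg0 t ht))
    · rw [h.coefA_diag hγ hρ₀ (hmem x hx), hq]
  · refine memLp_top_duct (k := fun t => ![0, D.m₀] i / (ρ t * D.sonicGap (ρ t))) ?_
      fun x hx => ?_
    · exact continuousOn_const.div (hρ.mul hg) fun t ht => mul_ne_zero (hρ0 t ht) (hg0 t ht)
    · rw [h.coefB_eq hγ hρ₀ (hmem x hx), hq]
  · refine memLp_top_duct (k := fun t => -![0, D.m₀] i / (ρ t * D.sonicGap (ρ t))) ?_
      fun x hx => ?_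
    · exact continuousOn_const.div (hρ.mul hg) fun t ht => mul_ne_zero (hρ0 t ht) (hg0 t ht)
    · rw [h.coefC_eq hγ hρ₀ (hmem x hx), hq]
  · refine memLp_top_duct (k := fun t => -ρ t / D.sonicGap (ρ t)) ?_ fun x hx => ?_
    · exact hρ.neg.div hg hg0
    · rw [h.coefD_eq hγ hρ₀ (hmem x hx)]

/-- The diagonal of the bilinear form: the mixed terms cancel. -/
theorem bilinForm_self (h : D.IsBackground ρ G) (hγ : 1 < D.γ)
    (hρ₀ : D.criticalDensity < D.ρ₀) (hb : BoundedCoefs D G) (p : H1 D.L × H1 D.L) :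
    bilinForm D G p p = (∑ i, weightedForm (hb.a i) (p.1.grad i) (p.1.grad i)) +
      (∑ i, ‖p.2.grad i‖ ^ 2) + weightedForm hb.d p.2.val p.2.val := by
  have hcross : ∀ i, weightedForm (hb.b i) p.2.val (p.1.grad i) +
      weightedForm (hb.c i) (p.1.grad i) p.2.val = 0 := by
    intro i
    rw [weightedForm_apply, weightedForm_apply, ← integral_add
      (integrable_weighted (hb.b i) _ _) (integrable_weighted (hb.c i) _ _)]
    refine integral_eq_zero_of_ae ?_
    filter_upwards [ae_restrict_mem (measurableSet_duct D.L)] with x hx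
    have hx' : x.1 ∈ Icc 0 D.L := Ioo_subset_Icc_self hx.1
    rw [h.coefB_eq hγ hρ₀ hx', h.coefC_eq hγ hρ₀ hx', Pi.zero_apply]
    ring
  have hl2 : ∀ i, l2Form (p.2.grad i) (p.2.grad i) = ‖p.2.grad i‖ ^ 2 := fun i =>
    real_inner_self_eq_norm_sq (p.2.grad i)
  rw [bilinForm_eq hb]
  simp only [hl2, eq_neg_of_add_eq_zero_left (hcross _), Finset.sum_add_distrib,
    Finset.sum_neg_distrib]
  ring

theorem le_weightedForm_coefA (h : D.IsBackground ρ G) (hγ : 1 < D.γ)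
    (hρ₀ : D.criticalDensity < D.ρ₀) (hb : BoundedCoefs D G) {M : ℝ}
    (hM : ∀ t ∈ Icc 0 D.L, ρ t ≤ M) (i : Fin 2) (u : DuctL2 D.L) :
    1 / M * ‖u‖ ^ 2 ≤ weightedForm (hb.a i) u u := by
  refine mul_norm_sq_le_weightedForm _ ?_ _
  filter_upwards [ae_restrict_mem (measurableSet_duct D.L)] with x hx
  have hx' : x.1 ∈ Icc 0 D.L := Ioo_subset_Icc_self hx.1
  have hpos := h.density_pos _ hx'
  have hgap := h.sonicGap_pos hγ hρ₀ hx'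
  rw [h.coefA_diag hγ hρ₀ hx']
  have h1 : 1 / M ≤ 1 / ρ x.1 := one_div_le_one_div_of_le hpos (hM _ hx')
  have h2 : 0 ≤ D.gradPsi₀ x i ^ 2 / (ρ x.1 ^ 3 * D.sonicGap (ρ x.1)) := by positivity
  linarith

theorem le_weightedForm_coefD (h : D.IsBackground ρ G) (hγ : 1 < D.γ)
    (hρ₀ : D.criticalDensity < D.ρ₀) (hL : 0 < D.L) (hb : BoundedCoefs D G) {δ₀ : ℝ}
    (hsmall : D.IsSmall ρ δ₀) (u : DuctL2 D.L) :
    -(2 * (1 - δ₀) / D.L ^ 2) * ‖u‖ ^ 2 ≤ weightedForm hb.d u u := by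
  refine mul_norm_sq_le_weightedForm _ ?_ _
  filter_upwards [ae_restrict_mem (measurableSet_duct D.L)] with x hx
  have hx' : x.1 ∈ Icc 0 D.L := Ioo_subset_Icc_self hx.1
  have hgap := h.sonicGap_pos hγ hρ₀ hx'
  have h1 := hsmall x hx
  rw [h.coefD_eq hγ hρ₀ hx', neg_div, neg_le_neg_iff, div_le_div_iff₀ hgap (by positivity)]
  rw [div_le_iff₀ (by positivity)] at h1
  linarith

/-- Here `v₀, v₁, v₂` and `w₀, w₁, w₂` stand for the squared norms of the values and derivatives of
the two components, and `A₁, A₂, E` for the weighted terms. -/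
theorem coercivity_arith {l m δ v₀ v₁ v₂ w₀ w₁ w₂ A₁ A₂ E : ℝ} (hl : 0 < l) (hm : 0 < m)
    (hmδ : m ≤ δ) (hδ : δ ≤ 1) (hv₂ : 0 ≤ v₂) (hw₁ : 0 ≤ w₁) (hw₂ : 0 ≤ w₂)
    (hv : v₀ ≤ l ^ 2 / 2 * v₁) (hw : w₀ ≤ l ^ 2 / 2 * w₁)
    (h₁ : m * v₁ ≤ A₁) (h₂ : m * v₂ ≤ A₂) (hE : -(2 * (1 - δ) / l ^ 2) * w₀ ≤ E) :
    m / (2 + l ^ 2) * (2 * ((v₀ + (v₁ + v₂)) + (w₀ + (w₁ + w₂)))) ≤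
      A₁ + A₂ + (w₁ + w₂) + E := by
  have hdP : -(1 - δ) * w₁ ≤ E := by
    -- The Poincaré factor l²/2 cancels the 2/l² of the smallness condition, leaving δ w₁ after
    -- absorption.
    have e1 : 2 * (1 - δ) / l ^ 2 * w₀ ≤ 2 * (1 - δ) / l ^ 2 * (l ^ 2 / 2 * w₁) :=
      mul_le_mul_of_nonneg_left hw
        (div_nonneg (mul_nonneg zero_le_two (sub_nonneg.2 hδ)) (sq_nonneg _))
    have e2 : 2 * (1 - δ) / l ^ 2 * (l ^ 2 / 2 * w₁) = (1 - δ) * w₁ := by field_simp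
    linarith
  have g1 : m * w₁ ≤ δ * w₁ := by gcongr
  have g2 : m * w₂ ≤ 1 * w₂ := mul_le_mul_of_nonneg_right (hmδ.trans hδ) hw₂
  -- Poincaré in the form 2v₀ ≤ l²v₁ explains the factor 2 + l². The leading 2 pays for squaring a
  -- sum of two norms.
  have hS : 2 * ((v₀ + (v₁ + v₂)) + (w₀ + (w₁ + w₂))) ≤ (2 + l ^ 2) * (v₁ + v₂ + (w₁ + w₂)) := by
    have q1 : 0 ≤ l ^ 2 * v₂ := by positivity
    have q2 : 0 ≤ l ^ 2 * w₂ := by positivity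
    linarith
  calc _ ≤ m / (2 + l ^ 2) * ((2 + l ^ 2) * (v₁ + v₂ + (w₁ + w₂))) := by gcongr
    _ = m * (v₁ + v₂ + (w₁ + w₂)) := by field_simp
    _ ≤ _ := by linarith

/-- The coercivity estimate, with an explicit constant. -/
theorem coercive_bilinForm (h : D.IsBackground ρ G) (hγ : 1 < D.γ)
    (hρ₀ : D.criticalDensity < D.ρ₀) (hL : 0 < D.L) {δ₀ M m : ℝ}
    (hsmall : D.IsSmall ρ δ₀) (hM : ∀ t ∈ Icc 0 D.L, ρ t ≤ M) (hm : 0 < m)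
    (hmM : m ≤ 1 / M) (hmδ : m ≤ δ₀) (hδ : δ₀ ≤ 1) {p : H1 D.L × H1 D.L} (hp : p ∈ spaceH D.L) :
    m / (2 + D.L ^ 2) * pairNorm p ^ 2 ≤ bilinForm D G p p := by
  have hb := h.boundedCoefs hγ hρ₀
  rw [mem_spaceH_iff] at hp
  have P1 := poincare hL hp.1.1.2
  have P2 := poincare hL hp.2.2
  have ha : ∀ i, m * ‖p.1.grad i‖ ^ 2 ≤ weightedForm (hb.a i) (p.1.grad i) (p.1.grad i) :=
    fun i => (mul_le_mul_of_nonneg_right hmM (sq_nonneg _)).trans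
      (le_weightedForm_coefA h hγ hρ₀ hb hM i _)
  have key := coercivity_arith hL hm hmδ hδ (sq_nonneg ‖p.1.grad 1‖) (sq_nonneg ‖p.2.grad 0‖)
    (sq_nonneg ‖p.2.grad 1‖) P1 P2 (ha 0) (ha 1)
    (le_weightedForm_coefD h hγ hρ₀ hL hb hsmall p.2.val)
  have h1 : pairNorm p ^ 2 ≤ 2 * (p.1.norm ^ 2 + p.2.norm ^ 2) := add_sq_le
  rw [p.1.norm_sq, p.2.norm_sq, Fin.sum_univ_two, Fin.sum_univ_two] at h1
  rw [bilinForm_self h hγ hρ₀ hb, Fin.sum_univ_two, Fin.sum_univ_two]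
  exact (mul_le_mul_of_nonneg_left h1 (by positivity)).trans key

/-! ### Solvability -/

/-- A weak solution exists, by the Lax–Milgram theorem. -/
theorem exists_isWeakSolution (hb : BoundedCoefs D G) (hL : 0 < D.L) {c : ℝ} (hc : 0 < c)
    (hcoer : ∀ p ∈ spaceH D.L, c * pairNorm p ^ 2 ≤ bilinForm D G p p) {d : LinearData}
    (hd : d.IsC0 D.L) : ∃ p, IsWeakSolution D G d p := by
  obtain ⟨B, hB⟩ := exists_bilinForm_eq hb
  obtain ⟨ℓ, hℓ⟩ := exists_functional_eq hL hd
  have hcB : IsCoercive B := by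
    refine ⟨c, hc, fun v => ?_⟩
    rw [hB, mul_assoc, ← sq]
    refine le_trans ?_ (hcoer _ (toPair_mem v))
    gcongr
    exact norm_le_pairNorm v
  -- The Riesz representative of the functional is pulled back by the Lax–Milgram isomorphism.
  set w := (InnerProductSpace.toDual ℝ (energySpace D.L)).symm ℓ with hw
  set v := hcB.continuousLinearEquivOfBilin.symm w with hv
  refine ⟨toPair v, toPair_mem v, fun r hr => ?_⟩
  obtain ⟨z, rfl⟩ := exists_toPair_eq hr
  rw [← hB, ← hℓ, ← hcB.continuousLinearEquivOfBilin_apply, hv,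
    ContinuousLinearEquiv.apply_symm_apply, hw, InnerProductSpace.toDual_symm_apply]

/-- Weak solutions are unique. -/
theorem IsWeakSolution.unique (hb : BoundedCoefs D G) {c : ℝ} (hc : 0 < c)
    (hcoer : ∀ p ∈ spaceH D.L, c * pairNorm p ^ 2 ≤ bilinForm D G p p) {d : LinearData}
    {p q : H1 D.L × H1 D.L} (hp : IsWeakSolution D G d p) (hq : IsWeakSolution D G d q) :
    p = q := by
  obtain ⟨B, hB⟩ := exists_bilinForm_eq hb
  obtain ⟨v, rfl⟩ := exists_toPair_eq hp.1
  obtain ⟨w, rfl⟩ := exists_toPair_eq hq.1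
  -- Both equations are tested with the difference, on which coercivity then applies.
  have h1 := hp.2 _ (toPair_mem (v - w))
  have h2 := hq.2 _ (toPair_mem (v - w))
  rw [← hB] at h1 h2
  have h3 : B (v - w) (v - w) = 0 := by
    rw [map_sub B v w, sub_apply, h1, h2, sub_self]
  have h4 := hcoer _ (toPair_mem (v - w))
  rw [← hB, h3] at h4
  have h5 : pairNorm (toPair (v - w)) ^ 2 ≤ 0 := nonpos_of_mul_nonpos_right h4 hc
  have h6 : ‖v - w‖ ^ 2 ≤ 0 := le_trans (by gcongr; exact norm_le_pairNorm _) h5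
  have h7 : ‖v - w‖ = 0 := by
    have := le_antisymm h6 (sq_nonneg _)
    exact pow_eq_zero_iff two_ne_zero |>.1 this
  rw [sub_eq_zero.1 (norm_eq_zero.1 h7)]

end DuctFlow

end

/-! ### Assembly of the uniform constants -/

open DuctFlow
theorem lemma3p3 (D : BackgroundData) (δ₀ : ℝ)
    (hγ : 1 < D.γ) (hm₀ : 0 < D.m₀) (hS₀ : 0 < D.S₀) (hρ₀ : D.criticalDensity < D.ρ₀)
    (hL : 0 < D.L) (hδ₀ : δ₀ ∈ Set.Ioo (0 : ℝ) 1) :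
    ∃ c > 0, ∃ C > 0, ∀ ρ G : ℝ → ℝ, D.IsBackground ρ G → D.IsSmall ρ δ₀ →
      (∀ p ∈ spaceH D.L, c * pairNorm p ^ 2 ≤ bilinForm D G p p) ∧
      ∀ d : LinearData, d.IsC0 D.L →
        (∃! p : H1 D.L × H1 D.L, IsWeakSolution D G d p) ∧
        ∀ p : H1 D.L × H1 D.L, IsWeakSolution D G d p → pairNorm p ≤ C * d.norm D.L := by
  obtain ⟨M, hM0, hM⟩ := D.exists_density_bound hγ hρ₀ hL
  obtain ⟨K, hK0, hK⟩ := exists_functional_le hL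
  -- The bound 1/M serves the gradient of ζ and δ₀ what remains of the gradient of ω. M, K and hence
  -- c are fixed before the flow is chosen.
  have hm : 0 < min (1 / M) δ₀ := lt_min (by positivity) hδ₀.1
  set c := min (1 / M) δ₀ / (2 + D.L ^ 2) with hc
  have hc0 : 0 < c := by positivity
  refine ⟨c, hc0, K / c, by positivity, fun ρ G h hsmall => ?_⟩
  have hcoer : ∀ p ∈ spaceH D.L, c * pairNorm p ^ 2 ≤ bilinForm D G p p := fun p hp =>
    coercive_bilinForm h hγ hρ₀ hL hsmall (hM ρ G h) hm (min_le_left _ _) (min_le_right _ _)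
      hδ₀.2.le hp
  have hb := h.boundedCoefs hγ hρ₀
  refine ⟨hcoer, fun d hd => ⟨?_, fun p hp => ?_⟩⟩
  · obtain ⟨p, hp⟩ := exists_isWeakSolution hb hL hc0 hcoer hd
    exact ⟨p, hp, fun q hq => hq.unique hb hc0 hcoer hp⟩
  -- The solution is its own test function; one factor of the norm is then cancelled, the case of
  -- zero norm being treated apart.
  · have h1 : c * pairNorm p ^ 2 ≤ K * d.norm D.L * pairNorm p :=
      (hcoer p hp.1).trans (((hp.2 p hp.1).le.trans (le_abs_self _)).trans (hK d hd p hp.1))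
    rcases (pairNorm_nonneg p).eq_or_lt with h0 | h0
    · rw [← h0]
      have hn : 0 ≤ d.norm D.L := by
        have := fun i => supNorm_nonneg (closure (duct D.L)) (d.F i)
        have := fun i => supNorm_nonneg (closure (duct D.L)) (d.G i)
        exact add_nonneg (add_nonneg (add_nonneg (add_nonneg (supNorm_nonneg _ _)
          (supNorm_nonneg _ _)) (Finset.sum_nonneg fun i _ => supNorm_nonneg _ _))
          (Finset.sum_nonneg fun i _ => supNorm_nonneg _ _)) (supNorm_nonneg _ _)
      positivity
    · have h2 : c * pairNorm p ≤ K * d.norm D.L := by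
        refine le_of_mul_le_mul_right ?_ h0
        rw [mul_assoc, ← sq]
        exact h1
      rw [div_mul_eq_mul_div, le_div_iff₀ hc0]
      linarith
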